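/- **Theorem 3.1 (elliptic compensated compactness without a curl).** Let $m\le n$, let $\Omega\subset\mathbf R^n$ be a bounded open set and let $X=(X_1,\dots,X_m)$, $X_j=\sum_{i=1}^n c_{ji}\,\partial_i$, be a family of vector fields that are Lipschitz continuous on an open set $\Omega_0\supset\overline\Omega$. For $x,y\in\mathbf R^n$ let $d(x,y)\in[0,\infty]$ be the Carnot–Carathéodory distance, that is, the infimum of those $T\ge 0$ for which there is an absolutely continuous curve $\gamma:[0,T]\to\Omega_0$ with $\gamma(0)=x$, $\gamma(T)=y$ and, for a.e. $t$, $\langle\gamma'(t),\xi\rangle^2\le\sum_{j}\langle X_j(\gamma(t)),\xi\rangle^2$ for all $\xi\in\mathbf R^n$. Put $B_d(x,r)=\{y\in\Omega_0: d(x,y)<r\}$, write $|A|$ for the Lebesgue measure of $A$, and assume: * (H1) $d(x,y)<\infty$ for all $x,y\in\Omega_0$, and $d$ is continuous on $\Omega_0\times\Omega_0$ for the usual topology; * (H2) for every compact $K\subset\Omega_0$ there are $r_K,C_K>0$ such that $|B_d(x,2r)|\le C_K|B_d(x,r)|$ for all $x\in K$ and $0<r<r_K$; * (H3) there are $c,C>0$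 such that, for all $\bar x\in\Omega_0$ and $r>0$, with $B=B_d(\bar x,r)$ and $cB=B_d(\bar x,cr)$: if $\overline{cB}\subset\Omega_0$, then for every Lipschitz function $u$ on $\overline{cB}$ and every $x\in\overline B$ $$\Big|u(x)-\frac1{|B|}\int_B u\,dy\Big|\le C\int_{cB}|Xu(y)|\,\frac{d(x,y)}{|B_d(x,d(x,y))|}\,dy;$$ * (LIC) there is a Lebesgue null set $Z_X\subset\Omega$ such that $X_1(x),\dots,X_m(x)$ are linearly independent for every $x\in\Omega\setminus Z_X$. Let $2\le p<\infty$ and $\frac1p+\frac1{p'}=1$. For $u\in L^p(\Omega)$ define $Xu=(X_1u,\dots,X_mu)$ in the sense of distributions, $\langle X_ju,\varphi\rangle=-\int_\Omega u\sum_i\partial_i(c_{ji}\varphi)\,dx$ for $\varphi\in C_c^\infty(\Omega)$. Let $W^{1,p}_X(\Omega)=\{u\in L^p(\Omega): Xu\in L^p(\Omega;\mathbf R^m)\}$, with norm $\big(\|u\|_{L^p}^p+\|Xu\|_{L^p}^p\big)^{1/p}$, let $V=W^{1,p}_{X,0}(\Omega)$ be the closure of $C^1_c(\Omega)\cap W^{1,p}_X(\Omega)$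 in $W^{1,p}_X(\Omega)$, and let $V'$ be its dual. For $M\in L^{p'}(\Omega;\mathbf R^m)$ let $\mathrm{div}_XM\in V'$ be the functional $w\mapsto\int_\Omega (M,Xw)_{\mathbf R^m}\,dx$. Let $v_h,v\in V$ and $M_h,M\in L^{p'}(\Omega;\mathbf R^m)$, $h\in\mathbf N$, be such that $v_h\rightharpoonup v$ weakly in $V$ and $M_h\rightharpoonup M$ weakly in $L^{p'}(\Omega;\mathbf R^m)$, and suppose that there is $g\in V'$, independent of $h$, with $\mathrm{div}_XM_h=g$ in $V'$ for every $h$. Then $(M_h,Xv_h)_{\mathbf R^m}$ and $(M,Xv)_{\mathbf R^m}$ are locally integrable on $\Omega$, and $$(M_h,Xv_h)_{\mathbf R^m}\to(M,Xv)_{\mathbf R^m}\quad\text{in }\mathcal D'(\Omega),$$ that is, $\int_\Omega(M_h,Xv_h)_{\mathbf R^m}\,\varphi\,dx\to\int_\Omega(M,Xv)_{\mathbf R^m}\,\varphi\,dx$ for every $\varphi\in C_c^\infty(\Omega)$. -/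

import Mathlib

open MeasureTheory Set Filter Topology
open scoped ENNReal NNReal

noncomputable section

namespace XGrad

/-- The Euclidean space `ℝᵏ`, with its Euclidean norm, inner product and Lebesgue measure. -/
abbrev E (k : ℕ) : Type := EuclideanSpace ℝ (Fin k)

/-! ### Carnot–Carathéodory distance -/

/-- `γ : [0, T] → Ω₀` is a sub-unit curve for the family `X`: it is absolutely continuous, and for
almost every `t ∈ [0, T]` one has `⟨γ'(t), ξ⟩² ≤ ∑ⱼ ⟨Xⱼ(γ(t)), ξ⟩²` for all `ξ`. -/
def IsSubunitCurve {n m : ℕ} (Ω₀ : Set (E n)) (X : Fin m → E n → E n) (T : ℝ) (γ : ℝ → E n) :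
    Prop :=
  AbsolutelyContinuousOnInterval γ 0 T ∧ (∀ t ∈ Icc 0 T, γ t ∈ Ω₀) ∧
    ∀ᵐ t ∂(volume.restrict (Icc 0 T)), ∀ ξ : E n,
      (inner ℝ (deriv γ t) ξ) ^ 2 ≤ ∑ j, (inner ℝ (X j (γ t)) ξ) ^ 2

/-- The Carnot–Carathéodory distance `d(x, y) ∈ [0, ∞]`: the infimum of the `T ≥ 0` for which some
sub-unit curve `γ : [0, T] → Ω₀` joins `x` to `y` (`∞` if there is none). -/
def ccDist {n m : ℕ} (Ω₀ : Set (E n)) (X : Fin m → E n → E n) (x y : E n) : ℝ≥0∞ :=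
  ⨅ (T : ℝ) (_ : 0 ≤ T ∧ ∃ γ : ℝ → E n, IsSubunitCurve Ω₀ X T γ ∧ γ 0 = x ∧ γ T = y),
    ENNReal.ofReal T

/-- The open metric ball `B_d(x, r) = {y ∈ Ω₀ : d(x, y) < r}`. -/
def ccBall {n m : ℕ} (Ω₀ : Set (E n)) (X : Fin m → E n → E n) (x : E n) (r : ℝ≥0∞) :
    Set (E n) :=
  {y ∈ Ω₀ | ccDist Ω₀ X x y < r}

/-- The pointwise `X`-gradient `Xu(x) = (X₁u(x), …, X_m u(x))` of a function `u` differentiable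
at `x`, where `X_j u(x) = ∑ᵢ c_{ji}(x) ∂ᵢu(x) = Du(x)[X_j(x)]`. -/
def pointGrad {n m : ℕ} (X : Fin m → E n → E n) (u : E n → ℝ) (x : E n) : E m :=
  WithLp.toLp 2 fun j => fderiv ℝ u x (X j x)

/-! ### The setting -/

/-- A bounded open set `Ω ⊆ ℝⁿ` and a family `X = (X₁, …, X_m)` of vector fields that are Lipschitz
continuous on an open neighbourhood `Ω₀` of the closure of `Ω`. The `i`-th coordinate of `X j x` is
the coefficient `c_{ji}(x)`. -/
structure Setting (n m : ℕ) where
  Ω : Set (E n)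
  Ω₀ : Set (E n)
  X : Fin m → E n → E n
  isOpen : IsOpen Ω
  isBounded : Bornology.IsBounded Ω
  isOpen' : IsOpen Ω₀
  closure_subset : closure Ω ⊆ Ω₀
  lipschitz : ∀ j, ∃ K : ℝ≥0, LipschitzOnWith K (X j) Ω₀

variable {n m : ℕ}

namespace Setting

/-- (H1): `d` is finite on `Ω₀ × Ω₀` and continuous there for the Euclidean topology. -/
def H1 (S : Setting n m) : Prop :=
  (∀ x ∈ S.Ω₀, ∀ y ∈ S.Ω₀, ccDist S.Ω₀ S.X x y < ∞) ∧
    ContinuousOn (fun z : E n × E n => ccDist S.Ω₀ S.X z.1 z.2) (S.Ω₀ ×ˢ S.Ω₀)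

/-- (H2): local doubling of the Lebesgue measure of metric balls. -/
def H2 (S : Setting n m) : Prop :=
  ∀ K : Set (E n), IsCompact K → K ⊆ S.Ω₀ → ∃ r_K > (0 : ℝ), ∃ C_K > (0 : ℝ),
    ∀ x ∈ K, ∀ r : ℝ, 0 < r → r < r_K →
      volume (ccBall S.Ω₀ S.X x (ENNReal.ofReal (2 * r))) ≤
        ENNReal.ofReal C_K * volume (ccBall S.Ω₀ S.X x (ENNReal.ofReal r))

/-- (H3): the representation formula on metric balls `B = B_d(x₀, r)` such that the closure of
`cB = B_d(x₀, c r)` lies in `Ω₀`. The right-hand side is an integral with values in `[0, ∞]`. -/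
def H3 (S : Setting n m) : Prop :=
  ∃ c > (0 : ℝ), ∃ C > (0 : ℝ), ∀ x₀ ∈ S.Ω₀, ∀ r > (0 : ℝ),
    closure (ccBall S.Ω₀ S.X x₀ (ENNReal.ofReal (c * r))) ⊆ S.Ω₀ →
    ∀ u : E n → ℝ,
      (∃ K : ℝ≥0,
        LipschitzOnWith K u (closure (ccBall S.Ω₀ S.X x₀ (ENNReal.ofReal (c * r))))) →
      ∀ x ∈ closure (ccBall S.Ω₀ S.X x₀ (ENNReal.ofReal r)),
        ENNReal.ofReal |u x - ⨍ y in ccBall S.Ω₀ S.X x₀ (ENNReal.ofReal r), u y| ≤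
          ENNReal.ofReal C *
            ∫⁻ y in ccBall S.Ω₀ S.X x₀ (ENNReal.ofReal (c * r)),
              ‖pointGrad S.X u y‖ₑ *
                (ccDist S.Ω₀ S.X x y / volume (ccBall S.Ω₀ S.X x (ccDist S.Ω₀ S.X x y)))

/-- (LIC): the vectors `X₁(x), …, X_m(x)` are linearly independent for `x ∈ Ω` outside a Lebesgue
null set. -/
def LIC (S : Setting n m) : Prop :=
  ∃ Z ⊆ S.Ω, volume Z = 0 ∧ ∀ x ∈ S.Ω \ Z, LinearIndependent ℝ fun j => S.X j x

/-- Lebesgue measure on `Ω`. -/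
abbrev μ (S : Setting n m) : Measure (E n) := volume.restrict S.Ω

/-- `φ ∈ C_c^k(Ω)`, as a function on `ℝⁿ` vanishing outside `Ω`; here `k : ℕ∞`, so that `k = ⊤` means
`φ ∈ C_c^∞(Ω)`. -/
def IsTest (S : Setting n m) (k : ℕ∞) (φ : E n → ℝ) : Prop :=
  ContDiff ℝ k φ ∧ HasCompactSupport φ ∧ tsupport φ ⊆ S.Ω

/-- The formal adjoint `X_jᵀ φ = - ∑ᵢ ∂ᵢ (c_{ji} φ)`; the derivatives exist almost everywhere. -/
def adj (S : Setting n m) (j : Fin m) (φ : E n → ℝ) (x : E n) : ℝ :=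
  -∑ i, fderiv ℝ (fun y => S.X j y i * φ y) x (EuclideanSpace.single i 1)

/-- `w = Xu` in the sense of distributions on `Ω`: `∫_Ω u X_jᵀφ = ∫_Ω w_j φ` for all `j` and all
`φ ∈ C_c^∞(Ω)`. -/
def IsXGrad (S : Setting n m) (u : E n → ℝ) (w : E n → E m) : Prop :=
  ∀ (j : Fin m) (φ : E n → ℝ), S.IsTest ⊤ φ →
    ∫ x in S.Ω, u x * S.adj j φ x = ∫ x in S.Ω, w x j * φ x

/-! ### Integrability facts that make the spaces below linear -/

instance instFin (S : Setting n m) : IsFiniteMeasure S.μ :=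
  isFiniteMeasure_restrict.2 S.isBounded.measure_lt_top.ne

theorem adj_bounded (S : Setting n m) (j : Fin m) {φ : E n → ℝ} (hφ : S.IsTest ⊤ φ) :
    ∃ C : ℝ, ∀ x ∈ S.Ω, ‖S.adj j φ x‖ ≤ C := by
  obtain ⟨K, hK⟩ := S.lipschitz j
  have hKΩ : LipschitzOnWith K (S.X j) S.Ω := hK.mono (subset_closure.trans S.closure_subset)
  have hc1 : Continuous φ := hφ.1.continuous
  obtain ⟨A, hA⟩ := hφ.2.1.exists_bound_of_continuous hc1
  have hd1 : Differentiable ℝ φ := hφ.1.differentiable (by simp)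
  obtain ⟨B, hB⟩ := (hφ.2.1.fderiv (𝕜 := ℝ)).exists_bound_of_continuous
    (hφ.1.continuous_fderiv (by simp))
  have hlipφ : LipschitzWith B.toNNReal φ :=
    lipschitzWith_of_nnnorm_fderiv_le hd1 fun x => by
      rw [← NNReal.coe_le_coe]
      exact (hB x).trans (Real.le_coe_toNNReal B)
  obtain ⟨D, hD⟩ : ∃ D : ℝ, ∀ x ∈ S.Ω, ‖S.X j x‖ ≤ D := by
    obtain ⟨D, hD⟩ := S.isBounded.isCompact_closure.exists_bound_of_continuousOn
      (hK.continuousOn.mono S.closure_subset)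
    exact ⟨D, fun x hx => hD x (subset_closure hx)⟩
  have hD' : ∀ x ∈ S.Ω, ∀ i, |S.X j x i| ≤ |D| := fun x hx i =>
    ((Real.norm_eq_abs _).symm.le.trans (PiLp.norm_apply_le (S.X j x) i)).trans
      ((hD x hx).trans (le_abs_self D))
  set L : ℝ := |D| * B.toNNReal + K * |A| with hL
  have hL0 : 0 ≤ L := by positivity
  have hlip : ∀ i, LipschitzOnWith L.toNNReal (fun y => S.X j y i * φ y) S.Ω := by
    intro i
    refine LipschitzOnWith.of_dist_le_mul fun x hx y hy => ?_
    rw [Real.coe_toNNReal _ hL0, Real.dist_eq]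
    have e : S.X j x i * φ x - S.X j y i * φ y =
        S.X j x i * (φ x - φ y) + (S.X j x i - S.X j y i) * φ y := by ring
    have e1 : |φ x - φ y| ≤ B.toNNReal * dist x y := hlipφ.dist_le_mul x y
    have e2 : |S.X j x i - S.X j y i| ≤ K * dist x y := by
      have h := hKΩ.dist_le_mul x hx y hy
      rw [dist_eq_norm (S.X j x)] at h
      exact (PiLp.norm_apply_le (S.X j x - S.X j y) i).trans h
    have e3 : |φ y| ≤ |A| := (hA y).trans (le_abs_self A)
    calc |S.X j x i * φ x - S.X j y i * φ y|
        ≤ |S.X j x i| * |φ x - φ y| + |S.X j x i - S.X j y i| * |φ y| := by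
          rw [e, ← abs_mul, ← abs_mul]
          exact abs_add_le _ _
      _ ≤ |D| * (B.toNNReal * dist x y) + (K * dist x y) * |A| := by
          have := hD' x hx i
          gcongr
      _ = L * dist x y := by rw [hL]; ring
  refine ⟨∑ _i : Fin n, L, fun x hx => ?_⟩
  rw [adj, norm_neg]
  refine norm_sum_le_of_le _ fun i _ => ?_
  refine (ContinuousLinearMap.le_opNorm _ _).trans ?_
  have h1 := norm_fderiv_le_of_lipschitzOn ℝ (S.isOpen.mem_nhds hx) (hlip i)
  rw [Real.coe_toNNReal _ hL0] at h1
  simpa using h1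

theorem integrable_mul_adj (S : Setting n m) {p : ℝ≥0∞} [Fact (1 ≤ p)] (u : Lp ℝ p S.μ)
    (j : Fin m) {φ : E n → ℝ} (hφ : S.IsTest ⊤ φ) :
    Integrable (fun x => u x * S.adj j φ x) S.μ := by
  obtain ⟨C, hC⟩ := S.adj_bounded j hφ
  have hm : Measurable (S.adj j φ) :=
    (Finset.measurable_sum _ fun i _ => measurable_fderiv_apply_const ℝ _ _).neg
  exact ((Lp.memLp u).integrable Fact.out).mul_bdd (c := C) hm.aestronglyMeasurable
    ((ae_restrict_iff' S.isOpen.measurableSet).2 (Eventually.of_forall hC))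

theorem integrable_coord_mul (S : Setting n m) {p : ℝ≥0∞} [Fact (1 ≤ p)] (w : Lp (E m) p S.μ)
    (j : Fin m) {φ : E n → ℝ} (hφ : S.IsTest ⊤ φ) :
    Integrable (fun x => w x j * φ x) S.μ := by
  have hc : Continuous φ := hφ.1.continuous
  obtain ⟨A, hA⟩ := hφ.2.1.exists_bound_of_continuous hc
  have hw : Integrable (fun x => w x j) S.μ :=
    (EuclideanSpace.proj (𝕜 := ℝ) j).integrable_comp ((Lp.memLp w).integrable Fact.out)
  exact hw.mul_bdd (c := A) hc.aestronglyMeasurable (Eventually.of_forall hA)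

/-! ### The spaces `W^{1,p}_X(Ω)` and `V = W^{1,p}_{X,0}(Ω)` -/

/-- `W^{1,p}_X(Ω)`, each `u` being recorded as the pair `(u, Xu) ∈ L^p(Ω) × L^p(Ω; ℝᵐ)` (`Xu` is
determined by `u`). The norm inherited from `WithLp p` is `(‖u‖_p ^ p + ‖Xu‖_p ^ p) ^ (1 / p)`. -/
def W (S : Setting n m) (p : ℝ≥0∞) [Fact (1 ≤ p)] :
    Submodule ℝ (WithLp p (Lp ℝ p S.μ × Lp (E m) p S.μ)) where
  carrier := {z | S.IsXGrad z.fst z.snd}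
  zero_mem' := by
    intro j φ _
    have e1 : ∀ᵐ x ∂S.μ, (0 : Lp ℝ p S.μ) x * S.adj j φ x = 0 := by
      filter_upwards [Lp.coeFn_zero ℝ p S.μ] with x hx
      rw [hx]; simp
    have e2 : ∀ᵐ x ∂S.μ, (0 : Lp (E m) p S.μ) x j * φ x = 0 := by
      filter_upwards [Lp.coeFn_zero (E m) p S.μ] with x hx
      rw [hx]; simp
    exact (integral_eq_zero_of_ae e1).trans (integral_eq_zero_of_ae e2).symm
  add_mem' := by
    intro a b ha hb j φ hφ
    have e1 : ∀ᵐ x ∂S.μ, (a.fst + b.fst) x * S.adj j φ x =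
        a.fst x * S.adj j φ x + b.fst x * S.adj j φ x := by
      filter_upwards [Lp.coeFn_add a.fst b.fst] with x hx
      rw [hx]; simp [add_mul]
    have e2 : ∀ᵐ x ∂S.μ, (a.snd + b.snd) x j * φ x =
        a.snd x j * φ x + b.snd x j * φ x := by
      filter_upwards [Lp.coeFn_add a.snd b.snd] with x hx
      rw [hx]; simp [add_mul]
    calc ∫ x in S.Ω, (a.fst + b.fst) x * S.adj j φ x
        = (∫ x in S.Ω, a.fst x * S.adj j φ x) + ∫ x in S.Ω, b.fst x * S.adj j φ x := by
          rw [integral_congr_ae e1]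
          exact integral_add (S.integrable_mul_adj a.fst j hφ) (S.integrable_mul_adj b.fst j hφ)
      _ = (∫ x in S.Ω, a.snd x j * φ x) + ∫ x in S.Ω, b.snd x j * φ x := by
          rw [ha j φ hφ, hb j φ hφ]
      _ = ∫ x in S.Ω, (a.snd + b.snd) x j * φ x := by
          rw [integral_congr_ae e2]
          exact (integral_add (S.integrable_coord_mul a.snd j hφ)
            (S.integrable_coord_mul b.snd j hφ)).symm
  smul_mem' := by
    intro t a ha j φ hφ
    have e1 : ∀ᵐ x ∂S.μ, (t • a.fst) x * S.adj j φ x = t * (a.fst x * S.adj j φ x) := by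
      filter_upwards [Lp.coeFn_smul t a.fst] with x hx
      rw [hx]; simp [mul_assoc]
    have e2 : ∀ᵐ x ∂S.μ, (t • a.snd) x j * φ x = t * (a.snd x j * φ x) := by
      filter_upwards [Lp.coeFn_smul t a.snd] with x hx
      rw [hx]; simp [mul_assoc]
    calc ∫ x in S.Ω, (t • a.fst) x * S.adj j φ x
        = t * ∫ x in S.Ω, a.fst x * S.adj j φ x := by
          rw [integral_congr_ae e1, integral_const_mul]
      _ = t * ∫ x in S.Ω, a.snd x j * φ x := by rw [ha j φ hφ]
      _ = ∫ x in S.Ω, (t • a.snd) x j * φ x := by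
          rw [integral_congr_ae e2, integral_const_mul]

/-- `C¹_c(Ω) ∩ W^{1,p}_X(Ω)`, as a subspace of `W^{1,p}_X(Ω)`. -/
def C1c (S : Setting n m) (p : ℝ≥0∞) [Fact (1 ≤ p)] : Submodule ℝ (S.W p) where
  carrier := {z | ∃ φ : E n → ℝ, S.IsTest 1 φ ∧ z.1.fst =ᵐ[S.μ] φ}
  zero_mem' := ⟨0, ⟨contDiff_const, HasCompactSupport.zero, by simp [tsupport]⟩,
    Lp.coeFn_zero ℝ p S.μ⟩
  add_mem' := by
    rintro a b ⟨φ, hφ, h1⟩ ⟨ψ, hψ, h2⟩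
    exact ⟨φ + ψ, ⟨hφ.1.add hψ.1, hφ.2.1.add hψ.2.1,
      (tsupport_add φ ψ).trans (union_subset hφ.2.2 hψ.2.2)⟩,
      (Lp.coeFn_add a.1.fst b.1.fst).trans (h1.add h2)⟩
  smul_mem' := by
    rintro t a ⟨φ, hφ, h1⟩
    exact ⟨t • φ, ⟨contDiff_const.smul hφ.1, hφ.2.1.smul_left (f := fun _ => t),
      (tsupport_smul_subset_right (fun _ => t) φ).trans hφ.2.2⟩,
      (Lp.coeFn_smul t a.1.fst).trans (h1.const_smul t)⟩

/-- `V = W^{1,p}_{X,0}(Ω)`: the closure of `C¹_c(Ω) ∩ W^{1,p}_X(Ω)` in `W^{1,p}_X(Ω)`, with the norm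
of `W^{1,p}_X(Ω)`. Its dual `V'` is `StrongDual ℝ (S.V p)`. -/
abbrev V (S : Setting n m) (p : ℝ≥0∞) [Fact (1 ≤ p)] : Submodule ℝ (S.W p) :=
  (S.C1c p).topologicalClosure

/-- The operator `V → L^p(Ω; ℝᵐ)`, `v ↦ Xv`. -/
def grad (S : Setting n m) (p : ℝ≥0∞) [Fact (1 ≤ p)] : S.V p →L[ℝ] Lp (E m) p S.μ :=
  WithLp.sndL p ℝ (Lp ℝ p S.μ) (Lp (E m) p S.μ) ∘L (S.W p).subtypeL ∘L (S.V p).subtypeL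

/-- `div_X M ∈ V'` for `M ∈ L^{p'}(Ω; ℝᵐ)`: the functional `v ↦ ∫_Ω (M, Xv) dx`
(see `divX_apply`). -/
def divX (S : Setting n m) (p q : ℝ≥0∞) [Fact (1 ≤ p)] [Fact (1 ≤ q)] [p.HolderConjugate q]
    (M : Lp (E m) q S.μ) : StrongDual ℝ (S.V p) :=
  ((innerSL ℝ).lpPairing S.μ p q).flip M ∘L S.grad p

theorem divX_apply (S : Setting n m) (p q : ℝ≥0∞) [Fact (1 ≤ p)] [Fact (1 ≤ q)]
    [p.HolderConjugate q] (M : Lp (E m) q S.μ) (v : S.V p) :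
    S.divX p q M v = ∫ x in S.Ω, inner ℝ (M x) (S.grad p v x) := by
  refine ((innerSL ℝ (E := E m)).lpPairing_eq_integral (S.grad p v) M).trans ?_
  refine integral_congr_ae (Eventually.of_forall fun x => ?_)
  exact real_inner_comm (M x) (S.grad p v x)

/-- Convergence `f_h → f` in `𝒟'(Ω)`, for locally integrable functions on `Ω`. -/
def TendstoDistrib (S : Setting n m) (f : ℕ → E n → ℝ) (f₀ : E n → ℝ) : Prop :=
  (∀ h, LocallyIntegrableOn (f h) S.Ω) ∧ LocallyIntegrableOn f₀ S.Ω ∧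
    ∀ φ : E n → ℝ, S.IsTest ⊤ φ →
      Tendsto (fun h => ∫ x in S.Ω, f h x * φ x) atTop (𝓝 (∫ x in S.Ω, f₀ x * φ x))

end Setting

/-- Weak convergence `y_h ⇀ y` in a normed space `Y`. -/
def WeakTendsto {Y : Type*} [NormedAddCommGroup Y] [NormedSpace ℝ Y] (y : ℕ → Y) (y₀ : Y) : Prop :=
  ∀ f : StrongDual ℝ Y, Tendsto (fun h => f (y h)) atTop (𝓝 (f y₀))

end XGrad

end

/-!
Testing `div_X M_h = g` against `φ v_h` gives
`∫ (M_h, X v_h) φ = ⟨g, φ v_h⟩ - ∫ v_h (M_h, X φ)`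
(`XGrad.Setting.integral_inner_mul_test`). Multiplication by `φ` is bounded on `V`, so the first
term on the right converges by the weak convergence of `v_h`. In the second one `M_h` converges only
weakly, and `v_h` has to converge strongly in `L^p` on the support of `φ`. The limit is then given
by the same identity for `M`, because `div_X M = g` as well. No information on the curl is needed.

The strong convergence is Rellich's theorem for `V`
(`XGrad.Setting.tendsto_restrict_of_weakTendsto`), and this is where the metric hypotheses enter. A
compact `K ⊆ Ω` is covered by finitely many balls `B_a` of radius `r`. On each of them the
representation formula bounds `|ψ - ⨍_{B_a} ψ|` by an integral operator applied to `|Xψ|`, with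
kernel `d(x, y) / |B(x, d(x, y))|` restricted to `d(x, y) ≲ r`. By doubling this kernel is at most a
dyadic sum of kernels of averaging operators on the scales `R, R / 2, R / 4, …`, where `R ≲ r`, and
Schur's test bounds the norm of the resulting operator on `L^p` by a multiple of `r`. So `ψ` is
controlled in `L^p(K)` by `ε ‖Xψ‖_p` and finitely many averages, first for `ψ ∈ C¹_c(Ω)`
(`XGrad.Setting.exists_eLpNorm_le_of_isTest`) and then in `V` by density; the averages of a weakly
null sequence tend to zero.

This uses the symmetry and the triangle inequality of the Carnot–Carathéodory distance, the
inclusion of small metric balls in `Ω₀`, and the fact that the distributional and the pointwise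
`X`-gradient agree on `C¹_c(Ω)` although the coefficients are merely Lipschitz
(`XGrad.Setting.IsTest.isXGrad`).
-/

namespace XGrad

/-! ### The Carnot–Carathéodory distance -/

/-- Absolute continuity is preserved by a `1`-Lipschitz, monotone or antitone change of parameter:
such a map sends disjoint intervals to disjoint intervals and does not increase lengths. -/
theorem absolutelyContinuousOnInterval_comp {Y : Type*} [PseudoMetricSpace Y] {f : ℝ → Y}
    {a b a' b' : ℝ} (hf : AbsolutelyContinuousOnInterval f a' b') {τ : ℝ → ℝ}
    (hτ : Monotone τ ∨ Antitone τ) (hlip : LipschitzWith 1 τ)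
    (hmaps : MapsTo τ (uIcc a b) (uIcc a' b')) :
    AbsolutelyContinuousOnInterval (f ∘ τ) a b := by
  rw [absolutelyContinuousOnInterval_iff] at hf ⊢
  intro ε hε
  obtain ⟨δ, hδ, H⟩ := hf ε hε
  refine ⟨δ, hδ, fun E hE hlen => ?_⟩
  refine H (E.1, fun i => (τ (E.2 i).1, τ (E.2 i).2)) ⟨fun i hi => ?_, fun i hi j hj hij => ?_⟩
    (lt_of_le_of_lt (Finset.sum_le_sum fun i _ => ?_) hlen)
  · exact ⟨hmaps (hE.1 i hi).1, hmaps (hE.1 i hi).2⟩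
  · have h := hE.2 hi hj hij
    simp only [Function.onFun, uIoc, Ioc_disjoint_Ioc] at h ⊢
    rcases hτ with h1 | h1
    · simp only [← h1.map_max, ← h1.map_min]
      exact h1 h
    · simp only [← h1.map_max, ← h1.map_min]
      exact h1 h
  · simpa using hlip.dist_le_mul (E.2 i).1 (E.2 i).2

variable {n m : ℕ} {Ω₀ : Set (E n)} {X : Fin m → E n → E n}

theorem ccDist_le {x y : E n} {T : ℝ} {γ : ℝ → E n} (hT : 0 ≤ T)
    (hγ : IsSubunitCurve Ω₀ X T γ) (h0 : γ 0 = x) (h1 : γ T = y) :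
    ccDist Ω₀ X x y ≤ ENNReal.ofReal T :=
  iInf₂_le T ⟨hT, γ, hγ, h0, h1⟩

theorem exists_subunitCurve {x y : E n} {s : ℝ≥0∞} (h : ccDist Ω₀ X x y < s) :
    ∃ T : ℝ, 0 ≤ T ∧ ENNReal.ofReal T < s ∧
      ∃ γ : ℝ → E n, IsSubunitCurve Ω₀ X T γ ∧ γ 0 = x ∧ γ T = y := by
  obtain ⟨T, hT⟩ := iInf_lt_iff.1 h
  obtain ⟨⟨hT0, γ, hγ⟩, hTs⟩ := iInf_lt_iff.1 hT
  exact ⟨T, hT0, hTs, γ, hγ⟩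

theorem ccDist_self {x : E n} (hx : x ∈ Ω₀) : ccDist Ω₀ X x x = 0 := by
  have h : IsSubunitCurve Ω₀ X 0 (fun _ => x) := by
    refine ⟨(LipschitzWith.const x).lipschitzOnWith.absolutelyContinuousOnInterval,
      fun _ _ => hx, Eventually.of_forall fun t ξ => ?_⟩
    simpa using Finset.sum_nonneg fun j _ => sq_nonneg _
  simpa using ccDist_le le_rfl h rfl rfl

/-- Running a sub-unit curve backwards. -/
theorem IsSubunitCurve.reverse {T : ℝ} (hT : 0 ≤ T) {γ : ℝ → E n}
    (hγ : IsSubunitCurve Ω₀ X T γ) : IsSubunitCurve Ω₀ X T (fun t => γ (T - t)) := by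
  have hmaps : MapsTo (fun t : ℝ => T - t) (Icc 0 T) (Icc 0 T) := fun t ht => by
    simp only [mem_Icc] at ht ⊢; constructor <;> linarith [ht.1, ht.2]
  refine ⟨?_, fun t ht => hγ.2.1 _ (hmaps ht), ?_⟩
  · refine absolutelyContinuousOnInterval_comp (τ := fun t => T - t) hγ.1
      (Or.inr fun s t h => by dsimp only; linarith) ?_ (by simpa [uIcc_of_le hT] using hmaps)
    exact LipschitzWith.of_dist_le_mul fun s t => by
      rw [NNReal.coe_one, one_mul, dist_sub_left]
  · have h := (ae_restrict_iff' measurableSet_Icc).1 hγ.2.2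
    rw [ae_restrict_iff' measurableSet_Icc]
    filter_upwards [(Measure.measurePreserving_sub_left volume T).quasiMeasurePreserving.ae h]
      with t ht htI ξ
    rw [deriv_comp_const_sub]
    simpa using ht (hmaps htI) ξ

/-- Running one sub-unit curve after another. -/
theorem IsSubunitCurve.concat {T₁ T₂ : ℝ} (h1 : 0 ≤ T₁) (h2 : 0 ≤ T₂) {γ₁ γ₂ : ℝ → E n}
    (hγ₁ : IsSubunitCurve Ω₀ X T₁ γ₁) (hγ₂ : IsSubunitCurve Ω₀ X T₂ γ₂) (h : γ₁ T₁ = γ₂ 0) :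
    ∃ γ, IsSubunitCurve Ω₀ X (T₁ + T₂) γ ∧ γ 0 = γ₁ 0 ∧ γ (T₁ + T₂) = γ₂ T₂ := by
  -- A sum of two time-changed curves, so that absolute continuity follows from that of a sum.
  set γ : ℝ → E n := fun t => (γ₁ (min t T₁) + γ₂ (max (t - T₁) 0)) - γ₂ 0 with hγ
  have hle : ∀ t ≤ T₁, γ t = γ₁ t := fun t ht => by
    simp [hγ, ht]
  have hge : ∀ t, T₁ ≤ t → γ t = γ₂ (t - T₁) := fun t ht => by
    simp [hγ, ht, h]
  refine ⟨γ, ⟨?_, ?_, ?_⟩, hle 0 h1, by rw [hge _ (by linarith)]; simp⟩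
  · refine AbsolutelyContinuousOnInterval.fun_sub (AbsolutelyContinuousOnInterval.fun_add ?_ ?_)
      (LipschitzWith.const (γ₂ 0)).lipschitzOnWith.absolutelyContinuousOnInterval
    · refine absolutelyContinuousOnInterval_comp (τ := fun t => min t T₁) hγ₁.1
        (Or.inl fun s t h => min_le_min_right _ h) (LipschitzWith.id.min_const T₁) fun t ht => ?_
      rw [uIcc_of_le (by linarith)] at ht ⊢
      exact ⟨le_min ht.1 h1, min_le_right _ _⟩
    · refine absolutelyContinuousOnInterval_comp (τ := fun t => max (t - T₁) 0) hγ₂.1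
        (Or.inl fun s t h => max_le_max_right _ (by linarith)) ?_ fun t ht => ?_
      · exact LipschitzWith.max_const
          (LipschitzWith.of_dist_le_mul fun s t => by simp [Real.dist_eq]) 0
      · rw [uIcc_of_le (by linarith)] at ht ⊢
        exact ⟨le_max_right _ _, max_le (by linarith [ht.2]) h2⟩
  · intro t ht
    rcases le_total t T₁ with h' | h'
    · rw [hle t h']; exact hγ₁.2.1 t ⟨ht.1, h'⟩
    · rw [hge t h']; exact hγ₂.2.1 _ ⟨by linarith, by linarith [ht.2]⟩
  · have e1 := (ae_restrict_iff' measurableSet_Icc).1 hγ₁.2.2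
    have e2 := (ae_restrict_iff' measurableSet_Icc).1 hγ₂.2.2
    have e3 : ∀ᵐ t : ℝ, t ≠ T₁ := by simp [ae_iff, measure_singleton]
    rw [ae_restrict_iff' measurableSet_Icc]
    filter_upwards [e1, (measurePreserving_sub_right volume T₁).quasiMeasurePreserving.ae e2, e3]
      with t ht1 ht2 ht3 htI ξ
    rcases lt_or_gt_of_ne ht3 with h' | h'
    · have e : γ =ᶠ[𝓝 t] γ₁ := by
        filter_upwards [Iio_mem_nhds h'] with s hs using hle s (le_of_lt hs)
      rw [e.deriv_eq, e.eq_of_nhds]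
      exact ht1 ⟨htI.1, h'.le⟩ ξ
    · have e : γ =ᶠ[𝓝 t] fun s => γ₂ (s - T₁) := by
        filter_upwards [Ioi_mem_nhds h'] with s hs using hge s (le_of_lt hs)
      rw [e.deriv_eq, e.eq_of_nhds, deriv_comp_sub_const]
      exact ht2 ⟨by linarith, by linarith [htI.2]⟩ ξ

theorem ccDist_comm (x y : E n) : ccDist Ω₀ X x y = ccDist Ω₀ X y x := by
  have key : ∀ x y : E n, ccDist Ω₀ X x y ≤ ccDist Ω₀ X y x := fun x y => by
    refine le_of_forall_gt fun s hs => ?_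
    obtain ⟨T, hT, hTs, γ, hγ, h0, h1⟩ := exists_subunitCurve hs
    exact (ccDist_le hT (hγ.reverse hT) (by simpa) (by simpa)).trans_lt hTs
  exact le_antisymm (key x y) (key y x)

theorem ccDist_triangle (x y z : E n) :
    ccDist Ω₀ X x z ≤ ccDist Ω₀ X x y + ccDist Ω₀ X y z := by
  refine ENNReal.le_iInf₂_add_iInf₂ fun T₁ h₁ T₂ h₂ => ?_
  obtain ⟨hT₁, γ₁, hγ₁, h01, h11⟩ := h₁
  obtain ⟨hT₂, γ₂, hγ₂, h02, h12⟩ := h₂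
  obtain ⟨γ, hγ, e0, e1⟩ := hγ₁.concat hT₁ hT₂ hγ₂ (h11.trans h02.symm)
  exact (ccDist_le (by positivity) hγ (e0.trans h01) (e1.trans h12)).trans
    (ENNReal.ofReal_add hT₁ hT₂).le

/-- A sub-unit curve has Euclidean speed at most `A` as long as `∑ⱼ |Xⱼ|² ≤ A²`, so it needs at
least the time `ρ / A` to leave a ball of radius `ρ` on which this bound holds. -/
theorem IsSubunitCurve.dist_lt {T ρ A : ℝ} (hT : 0 ≤ T) (hA : 0 < A) {γ : ℝ → E n}
    (hγ : IsSubunitCurve Ω₀ X T γ)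
    (hX : ∀ y ∈ Metric.closedBall (γ 0) ρ, ∑ j, ‖X j y‖ ^ 2 ≤ A ^ 2)
    (hTA : A * T < ρ) : dist (γ T) (γ 0) < ρ := by
  by_contra! hcon
  have hcont : ContinuousOn γ (Icc 0 T) := by simpa [uIcc_of_le hT] using hγ.1.continuousOn
  have hcd : ContinuousOn (fun t => dist (γ t) (γ 0)) (Icc 0 T) :=
    continuous_id.dist continuous_const |>.comp_continuousOn hcont
  -- The first time at which the curve is at distance `ρ`.
  obtain ⟨s, ⟨hsI, hsρ⟩, hmin⟩ :
      ∃ s, IsLeast (Icc 0 T ∩ (fun t => dist (γ t) (γ 0)) ⁻¹' Ici ρ) s :=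
    (isCompact_Icc.of_isClosed_subset (hcd.preimage_isClosed_of_isClosed isClosed_Icc isClosed_Ici)
      inter_subset_left).exists_isLeast ⟨T, ⟨hT, le_rfl⟩, hcon⟩
  have hin : ∀ t ∈ Ico 0 s, γ t ∈ Metric.closedBall (γ 0) ρ := fun t ht => by
    by_contra hnot
    have : ρ ≤ dist (γ t) (γ 0) := by
      rw [Metric.mem_closedBall, not_le] at hnot; exact hnot.le
    exact absurd (hmin ⟨⟨ht.1, ht.2.le.trans hsI.2⟩, this⟩) (not_le.2 ht.2)
  set ξ : E n := γ s - γ 0 with hξ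
  have hAC : AbsolutelyContinuousOnInterval γ 0 s :=
    hγ.1.mono (by rw [uIcc_of_le hsI.1, uIcc_of_le hT]; exact Icc_subset_Icc_right hsI.2)
  have hACi : AbsolutelyContinuousOnInterval (fun t => inner ℝ (γ t) ξ) 0 s := by
    rw [absolutelyContinuousOnInterval_iff] at hAC ⊢
    intro ε hε
    obtain ⟨δ, hδ, H⟩ := hAC (ε / (‖ξ‖ + 1)) (by positivity)
    refine ⟨δ, hδ, fun E hE hl => ?_⟩
    have h1 := H E hE hl
    rw [lt_div_iff₀ (by positivity)] at h1
    refine lt_of_le_of_lt ?_ h1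
    rw [Finset.sum_mul]
    refine Finset.sum_le_sum fun i _ => ?_
    rw [Real.dist_eq, ← inner_sub_left, dist_eq_norm]
    exact (abs_real_inner_le_norm _ _).trans (by gcongr; linarith)
  have hae : ∀ᵐ t : ℝ, t ∈ Ico 0 s → ‖deriv (fun t => inner ℝ (γ t) ξ) t‖ ≤ A * ‖ξ‖ := by
    filter_upwards [(ae_restrict_iff' measurableSet_Icc).1 hγ.2.2,
      hAC.boundedVariationOn.ae_differentiableAt_of_mem_uIcc] with t h1 h2 ht
    have hd : DifferentiableAt ℝ γ t := h2 (by rw [uIcc_of_le hsI.1]; exact ⟨ht.1, ht.2.le⟩)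
    have e : deriv (fun t => inner ℝ (γ t) ξ) t = inner ℝ (deriv γ t) ξ := by
      simpa using (hd.hasDerivAt.inner ℝ (hasDerivAt_const t ξ)).deriv
    rw [e]
    refine abs_le_of_sq_le_sq ?_ (by positivity)
    calc (inner ℝ (deriv γ t) ξ) ^ 2 ≤ ∑ j, (inner ℝ (X j (γ t)) ξ) ^ 2 :=
          h1 ⟨ht.1, ht.2.le.trans hsI.2⟩ ξ
      _ ≤ ∑ j, ‖X j (γ t)‖ ^ 2 * ‖ξ‖ ^ 2 := Finset.sum_le_sum fun j _ => by
          rw [← mul_pow]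
          exact sq_le_sq' (neg_le_of_abs_le (abs_real_inner_le_norm _ _)) (real_inner_le_norm _ _)
      _ = (∑ j, ‖X j (γ t)‖ ^ 2) * ‖ξ‖ ^ 2 := by rw [Finset.sum_mul]
      _ ≤ A ^ 2 * ‖ξ‖ ^ 2 := by gcongr; exact hX _ (hin t ht)
      _ = (A * ‖ξ‖) ^ 2 := by ring
  have hint := hACi.integral_deriv_eq_sub
  have hb : ‖∫ t in (0 : ℝ)..s, deriv (fun t => inner ℝ (γ t) ξ) t‖ ≤ A * ‖ξ‖ * |s - 0| := by
    refine intervalIntegral.norm_integral_le_of_norm_le_const_ae ?_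
    filter_upwards [hae, (by simp [ae_iff, measure_singleton] : ∀ᵐ t : ℝ, t ≠ s)] with t h1 h2 h3
    rw [uIoc_of_le hsI.1] at h3
    exact h1 ⟨h3.1.le, lt_of_le_of_ne h3.2 h2⟩
  rw [hint, ← inner_sub_left, ← hξ, real_inner_self_eq_norm_sq, sub_zero, abs_of_nonneg hsI.1,
    Real.norm_of_nonneg (by positivity)] at hb
  have hρ : ρ ≤ ‖ξ‖ := by rw [hξ, ← dist_eq_norm]; exact hsρ
  have hpos : 0 < ‖ξ‖ := lt_of_lt_of_le (lt_of_le_of_lt (by positivity) hTA) hρ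
  have : ‖ξ‖ ≤ A * s := le_of_mul_le_mul_right (by nlinarith) hpos
  nlinarith [hsI.2]

namespace Setting

variable (S : Setting n m)

/-- Metric balls of small radius around the points of a compact set stay inside `Ω₀`. -/
theorem exists_closure_ccBall_subset {K : Set (E n)} (hK : IsCompact K) (hKΩ : K ⊆ S.Ω₀) :
    ∃ δ > (0 : ℝ), ∀ x ∈ K, ∀ r ≤ δ,
      closure (ccBall S.Ω₀ S.X x (ENNReal.ofReal r)) ⊆ S.Ω₀ := by
  obtain ⟨ρ, hρ, hsub⟩ := hK.exists_cthickening_subset_open S.isOpen' hKΩ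
  have hcpt : IsCompact (Metric.cthickening ρ K) := hK.cthickening
  have hc : ContinuousOn (fun y => ∑ j, ‖S.X j y‖ ^ 2) (Metric.cthickening ρ K) := by
    refine continuousOn_finsetSum _ fun j _ => ?_
    obtain ⟨L, hL⟩ := S.lipschitz j
    exact ((hL.continuousOn.mono hsub).norm).pow 2
  obtain ⟨D, hD⟩ := hcpt.exists_bound_of_continuousOn hc
  set A : ℝ := 1 + |D| with hA
  have hA0 : 0 < A := by positivity
  have hball : ∀ x ∈ K, Metric.closedBall x ρ ⊆ Metric.cthickening ρ K := fun x hx =>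
    Metric.closedBall_subset_cthickening hx ρ
  refine ⟨ρ / A / 2, by positivity, fun x hx r hr => ?_⟩
  refine (closure_minimal (t := Metric.closedBall x ρ) (fun y hy => ?_)
    Metric.isClosed_closedBall).trans ((hball x hx).trans hsub)
  obtain ⟨T, hT, hTr, γ, hγ, h0, h1⟩ := exists_subunitCurve hy.2
  have hTr' : T < r := (ENNReal.ofReal_lt_ofReal_iff_of_nonneg hT).1 hTr
  have := hγ.dist_lt (ρ := ρ) hT hA0 (fun z hz => ?_) ?_
  · rw [h0, h1] at this; exact this.le
  · rw [h0] at hz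
    have h3 := (le_abs_self _).trans (hD z (hball x hx hz))
    nlinarith [le_abs_self D, abs_nonneg D]
  · have : A * (ρ / A / 2) = ρ / 2 := by field_simp
    nlinarith

end Setting

end XGrad

namespace XGrad

/-! ### Distributional and pointwise `X`-gradients -/

/-- The product of two Lipschitz functions, one of them compactly supported, is Lipschitz. -/
theorem exists_lipschitzWith_mul {Y : Type*} [PseudoMetricSpace Y] {f g : Y → ℝ} {K L : ℝ≥0}
    (hf : LipschitzWith K f) (hg : LipschitzWith L g) (hgc : HasCompactSupport g) :
    ∃ C, LipschitzWith C (fun y => f y * g y) := by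
  obtain ⟨A, hA⟩ := hgc.exists_bound_of_continuous hg.continuous
  obtain ⟨D, hD⟩ := hgc.isCompact.exists_bound_of_continuousOn hf.continuous.continuousOn
  have key : ∀ x ∈ tsupport g, ∀ y,
      |f x * g x - f y * g y| ≤ (|D| * L + K * |A|) * dist x y := fun x hx y => by
    have e : f x * g x - f y * g y = f x * (g x - g y) + (f x - f y) * g y := by ring
    have e1 : |g x - g y| ≤ L * dist x y := hg.dist_le_mul x y
    have e2 : |f x - f y| ≤ K * dist x y := hf.dist_le_mul x y
    have e3 : |f x| ≤ |D| := (hD x hx).trans (le_abs_self D)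
    have e4 : |g y| ≤ |A| := (hA y).trans (le_abs_self A)
    calc |f x * g x - f y * g y| ≤ |f x| * |g x - g y| + |f x - f y| * |g y| := by
          rw [e, ← abs_mul, ← abs_mul]; exact abs_add_le _ _
      _ ≤ |D| * (L * dist x y) + (K * dist x y) * |A| := by gcongr
      _ = _ := by ring
  refine ⟨(|D| * L + K * |A|).toNNReal, LipschitzWith.of_dist_le_mul fun x y => ?_⟩
  rw [Real.coe_toNNReal _ (by positivity), Real.dist_eq]
  by_cases hx : x ∈ tsupport g
  · exact key x hx y
  by_cases hy : y ∈ tsupport g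
  · rw [abs_sub_comm, dist_comm]; exact key y hy x
  · rw [image_eq_zero_of_notMem_tsupport hx, image_eq_zero_of_notMem_tsupport hy]
    simp only [mul_zero, sub_zero, abs_zero]; positivity

variable {n m : ℕ}

namespace Setting

variable {S : Setting n m}

theorem IsTest.continuous {k : ℕ∞} {φ : E n → ℝ} (h : S.IsTest k φ) : Continuous φ :=
  h.1.continuous

theorem IsTest.of_le {k l : ℕ∞} (hlk : l ≤ k) {φ : E n → ℝ} (h : S.IsTest k φ) : S.IsTest l φ :=
  ⟨h.1.of_le (by exact_mod_cast hlk), h.2⟩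

theorem IsTest.mul {k : ℕ∞} {φ ψ : E n → ℝ} (hφ : S.IsTest k φ) (hψ : S.IsTest k ψ) :
    S.IsTest k (fun x => φ x * ψ x) :=
  ⟨hφ.1.mul hψ.1, hφ.2.1.mul_right, (tsupport_mul_subset_left).trans hφ.2.2⟩

theorem IsTest.eq_zero {k : ℕ∞} {φ : E n → ℝ} (h : S.IsTest k φ) {x : E n} (hx : x ∉ S.Ω) :
    φ x = 0 :=
  image_eq_zero_of_notMem_tsupport fun hx' => hx (h.2.2 hx')

theorem IsTest.differentiable {φ : E n → ℝ} (h : S.IsTest 1 φ) : Differentiable ℝ φ :=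
  h.1.differentiable (by simp)

theorem IsTest.exists_lipschitzWith {φ : E n → ℝ} (h : S.IsTest 1 φ) :
    ∃ K, LipschitzWith K φ := by
  obtain ⟨B, hB⟩ := (h.2.1.fderiv (𝕜 := ℝ)).exists_bound_of_continuous
    (h.1.continuous_fderiv (by simp))
  exact ⟨B.toNNReal, lipschitzWith_of_nnnorm_fderiv_le h.differentiable fun x => by
    rw [← NNReal.coe_le_coe]; exact (hB x).trans (Real.le_coe_toNNReal B)⟩

theorem subset_Ω₀ (S : Setting n m) : S.Ω ⊆ S.Ω₀ := subset_closure.trans S.closure_subset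

/-- `c_{ji} φ` is Lipschitz on all of `ℝⁿ` for `φ ∈ C¹_c(Ω)`, although `c_{ji}` is only controlled
on `Ω₀`. -/
theorem IsTest.exists_lipschitzWith_coeff_mul {φ : E n → ℝ} (h : S.IsTest 1 φ) (j : Fin m)
    (i : Fin n) : ∃ K, LipschitzWith K (fun y => S.X j y i * φ y) := by
  obtain ⟨L, hL⟩ := S.lipschitz j
  have hLi : LipschitzOnWith L (fun y => S.X j y i) S.Ω₀ :=
    LipschitzOnWith.of_dist_le_mul fun x hx y hy => by
      have h := hL.dist_le_mul x hx y hy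
      rw [dist_eq_norm (S.X j x)] at h
      rw [Real.dist_eq]
      exact (PiLp.norm_apply_le (S.X j x - S.X j y) i).trans h
  obtain ⟨f, hf, hfe⟩ := hLi.extend_real
  obtain ⟨K, hK⟩ := h.exists_lipschitzWith
  obtain ⟨C, hC⟩ := exists_lipschitzWith_mul hf hK h.2.1
  refine ⟨C, ?_⟩
  convert! hC using 2 with y
  by_cases hy : y ∈ S.Ω
  · rw [← hfe (S.subset_Ω₀ hy)]
  · simp [h.eq_zero hy]

theorem pointGrad_apply (X : Fin m → E n → E n) (u : E n → ℝ) (x : E n) (j : Fin m) :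
    pointGrad X u x j = fderiv ℝ u x (X j x) := rfl

theorem fderiv_apply_eq_sum {u : E n → ℝ} (x v : E n) :
    fderiv ℝ u x v = ∑ i, v i * fderiv ℝ u x (EuclideanSpace.single i 1) := by
  conv_lhs => rw [← (EuclideanSpace.basisFun (Fin n) ℝ).sum_repr v]
  simp [map_sum]

theorem pointGrad_eq_zero (X : Fin m → E n → E n) {φ : E n → ℝ} {x : E n}
    (hx : x ∉ tsupport φ) : pointGrad X φ x = 0 := by
  have : fderiv ℝ φ x = 0 := by
    by_contra hne
    exact hx (support_fderiv_subset ℝ hne)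
  ext j
  simp [pointGrad_apply, this]

theorem IsTest.continuous_pointGrad {φ : E n → ℝ} (h : S.IsTest 1 φ) :
    Continuous (pointGrad S.X φ) := by
  refine continuous_iff_continuousAt.2 fun x => ?_
  by_cases hx : x ∈ tsupport φ
  · refine (PiLp.continuous_toLp 2 _).continuousAt.comp (continuousAt_pi.2 fun j => ?_)
    obtain ⟨L, hL⟩ := S.lipschitz j
    exact ((h.1.continuous_fderiv (by simp)).continuousAt).clm_apply
      (hL.continuousOn.continuousAt (S.isOpen'.mem_nhds (S.subset_Ω₀ (h.2.2 hx))))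
  · have : pointGrad S.X φ =ᶠ[𝓝 x] fun _ => 0 := by
      filter_upwards [(isClosed_tsupport φ).isOpen_compl.mem_nhds hx] with y hy
        using pointGrad_eq_zero S.X hy
    exact continuousAt_const.congr this.symm

theorem IsTest.hasCompactSupport_pointGrad {φ : E n → ℝ} (h : S.IsTest 1 φ) :
    HasCompactSupport (pointGrad S.X φ) :=
  HasCompactSupport.intro h.2.1 fun _ hx => pointGrad_eq_zero S.X hx

/-- Integration by parts: for `ψ ∈ C¹_c(Ω)` the pointwise `X`-gradient is the distributional one. -/
theorem IsTest.isXGrad {ψ : E n → ℝ} (h : S.IsTest 1 ψ) : S.IsXGrad ψ (pointGrad S.X ψ) := by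
  intro j φ hφ'
  have hφ : S.IsTest 1 φ := hφ'.of_le le_top
  obtain ⟨K, hK⟩ := h.exists_lipschitzWith
  choose C hC using fun i => hφ.exists_lipschitzWith_coeff_mul j i
  set e : Fin n → E n := fun i => EuclideanSpace.single i 1 with he
  have hcs : ∀ i, HasCompactSupport (fun y => S.X j y i * φ y) := fun i => hφ.2.1.mul_left
  have hL : ∀ i, ∫ x, fderiv ℝ ψ x (e i) * (S.X j x i * φ x) =
      -∫ x, fderiv ℝ (fun y => S.X j y i * φ y) x (e i) * ψ x := fun i => by
    have h1 := hK.integral_lineDeriv_mul_eq (μ := volume) (hC i) (hcs i) (e i)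
    have h2 : ∀ᵐ x, lineDeriv ℝ (fun y => S.X j y i * φ y) x (-(e i)) * ψ x =
        -(fderiv ℝ (fun y => S.X j y i * φ y) x (e i) * ψ x) := by
      filter_upwards [(hC i).ae_differentiableAt] with x hx
      rw [hx.lineDeriv_eq_fderiv, map_neg, neg_mul]
    rw [integral_congr_ae h2, integral_neg] at h1
    rw [← h1]
    exact integral_congr_ae (Eventually.of_forall fun x => by
      dsimp only; rw [(h.differentiable x).lineDeriv_eq_fderiv])
  have hint1 : ∀ i, Integrable (fun x => fderiv ℝ ψ x (e i) * (S.X j x i * φ x)) := fun i =>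
    (((h.1.continuous_fderiv (by simp)).clm_apply continuous_const).mul
      (hC i).continuous).integrable_of_hasCompactSupport (hcs i).mul_left
  have hint2 : ∀ i, Integrable
      (fun x => fderiv ℝ (fun y => S.X j y i * φ y) x (e i) * ψ x) := fun i => by
    refine (h.continuous.integrable_of_hasCompactSupport h.2.1).bdd_mul (c := C i * ‖e i‖)
      (measurable_fderiv_apply_const ℝ _ _).aestronglyMeasurable (Eventually.of_forall fun x => ?_)
    exact (ContinuousLinearMap.le_opNorm _ _).trans (by
      gcongr; exact norm_fderiv_le_of_lipschitz ℝ (hC i))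
  calc ∫ x in S.Ω, ψ x * S.adj j φ x = ∫ x, ψ x * S.adj j φ x :=
        setIntegral_eq_integral_of_forall_compl_eq_zero fun x hx => by simp [h.eq_zero hx]
    _ = ∫ x, -∑ i, fderiv ℝ (fun y => S.X j y i * φ y) x (e i) * ψ x := by
        refine integral_congr_ae (Eventually.of_forall fun x => ?_)
        simp only [adj, mul_neg, Finset.mul_sum]
        exact congrArg _ (Finset.sum_congr rfl fun i _ => mul_comm _ _)
    _ = ∑ i, ∫ x, fderiv ℝ ψ x (e i) * (S.X j x i * φ x) := by
        rw [integral_neg, integral_finsetSum _ fun i _ => hint2 i, ← Finset.sum_neg_distrib]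
        exact Finset.sum_congr rfl fun i _ => (hL i).symm
    _ = ∫ x, pointGrad S.X ψ x j * φ x := by
        rw [← integral_finsetSum _ fun i _ => hint1 i]
        refine integral_congr_ae (Eventually.of_forall fun x => ?_)
        dsimp only
        rw [pointGrad_apply, fderiv_apply_eq_sum, Finset.sum_mul]
        exact Finset.sum_congr rfl fun i _ => by ring
    _ = ∫ x in S.Ω, pointGrad S.X ψ x j * φ x :=
        (setIntegral_eq_integral_of_forall_compl_eq_zero fun x hx => by simp [hφ.eq_zero hx]).symm

/-- The product rule for the formal adjoint. It holds where the Lipschitz functions `c_{ji} η` are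
differentiable, hence almost everywhere. -/
theorem adj_mul_ae {φ η : E n → ℝ} (hφ : S.IsTest 1 φ) (hη : S.IsTest 1 η) (j : Fin m) :
    ∀ᵐ x, S.adj j (fun x => φ x * η x) x =
      φ x * S.adj j η x - pointGrad S.X φ x j * η x := by
  choose C hC using fun i => hη.exists_lipschitzWith_coeff_mul j i
  filter_upwards [ae_all_iff.2 fun i => (hC i).ae_differentiableAt (μ := volume)] with x hx
  have e : ∀ i, fderiv ℝ (fun y => S.X j y i * (φ y * η y)) x (EuclideanSpace.single i 1) =
      φ x * fderiv ℝ (fun y => S.X j y i * η y) x (EuclideanSpace.single i 1) +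
        (S.X j x i * fderiv ℝ φ x (EuclideanSpace.single i 1)) * η x := fun i => by
    have e0 : (fun y => S.X j y i * (φ y * η y)) = fun y => φ y * (S.X j y i * η y) := by
      funext y; ring
    rw [e0, fderiv_fun_mul (hφ.differentiable x) (hx i)]
    simp; ring
  rw [pointGrad_apply, fderiv_apply_eq_sum]
  simp only [adj, e, Finset.sum_add_distrib, Finset.mul_sum, Finset.sum_mul, mul_neg]
  ring

/-- The distributional `X`-gradient is unique. -/
theorem IsXGrad.ae_eq {u : E n → ℝ} {w w' : E n → E m} (h : S.IsXGrad u w) (h' : S.IsXGrad u w')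
    (hw : Integrable w S.μ) (hw' : Integrable w' S.μ) : w =ᵐ[S.μ] w' := by
  have hc : ∀ {f : E n → E m}, Integrable f S.μ → ∀ j, Integrable (fun x => f x j) S.μ :=
    fun hf j => (EuclideanSpace.proj (𝕜 := ℝ) j).integrable_comp hf
  have key : ∀ j, ∀ᵐ x ∂S.μ, w x j - w' x j = 0 := fun j => by
    rw [ae_restrict_iff' S.isOpen.measurableSet]
    refine S.isOpen.ae_eq_zero_of_integral_contDiff_smul_eq_zero
      (IntegrableOn.locallyIntegrableOn ((hc hw j).sub (hc hw' j))) fun φ h1 h2 h3 => ?_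
    have hφ : S.IsTest ⊤ φ := ⟨h1, h2, h3⟩
    obtain ⟨A, hA⟩ := h2.exists_bound_of_continuous hφ.continuous
    have hi : ∀ {f : E n → E m}, Integrable f S.μ → Integrable (fun x => f x j * φ x) S.μ :=
      fun hf => (hc hf j).mul_bdd (c := A) hφ.continuous.aestronglyMeasurable
        (Eventually.of_forall hA)
    rw [← setIntegral_eq_integral_of_forall_compl_eq_zero (s := S.Ω)
      fun x hx => by simp [hφ.eq_zero hx]]
    calc ∫ x in S.Ω, φ x • (w x j - w' x j) = ∫ x in S.Ω, (w x j * φ x - w' x j * φ x) :=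
          integral_congr_ae (Eventually.of_forall fun x => by simp; ring)
      _ = 0 := by
          rw [integral_sub (hi hw) (hi hw'), ← h j φ hφ, ← h' j φ hφ, sub_self]
  filter_upwards [ae_all_iff.2 key] with x hx
  ext j
  exact sub_eq_zero.1 (hx j)

end Setting

end XGrad

namespace XGrad

/-! ### Schur's test -/

/-- Schur's test on `L^p`: a nonnegative kernel whose row and column integrals are at most `A` acts
on `L^p` with norm at most `A`. -/
theorem lintegral_schur {α β : Type*} [MeasurableSpace α] [MeasurableSpace β] {μ : Measure α}
    {ν : Measure β} [SFinite μ] [SFinite ν] {p q : ℝ} (hpq : p.HolderConjugate q)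
    {κ : α → β → ℝ≥0∞} (hκ : Measurable (Function.uncurry κ)) {f : β → ℝ≥0∞} (hf : Measurable f)
    {A : ℝ≥0∞} (h1 : ∀ᵐ x ∂μ, ∫⁻ y, κ x y ∂ν ≤ A) (h2 : ∀ y, ∫⁻ x, κ x y ∂μ ≤ A) :
    ∫⁻ x, (∫⁻ y, f y * κ x y ∂ν) ^ p ∂μ ≤ A ^ p * ∫⁻ y, f y ^ p ∂ν := by
  have hκx : ∀ x, Measurable (κ x) := fun x => hκ.comp measurable_prodMk_left
  have hp0 := hpq.pos
  have hq0 := hpq.symm.pos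
  have hrow : ∀ x, (∫⁻ y, f y * κ x y ∂ν) ^ p ≤
      (∫⁻ y, κ x y ∂ν) ^ (p - 1) * ∫⁻ y, f y ^ p * κ x y ∂ν := fun x => by
    have hsplit : ∀ y, f y * κ x y =
        ((fun y => κ x y ^ (1 / q)) * fun y => f y * κ x y ^ (1 / p)) y := fun y => by
      have e : κ x y = κ x y ^ (1 / q) * κ x y ^ (1 / p) := by
        rw [← ENNReal.rpow_add_of_nonneg _ _ (by positivity) (by positivity), one_div, one_div,
          hpq.symm.inv_add_inv_eq_one, ENNReal.rpow_one]
      conv_lhs => rw [e]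
      simp only [Pi.mul_apply]
      ring
    have hh := ENNReal.lintegral_mul_le_Lp_mul_Lq ν hpq.symm
      ((hκx x).pow_const (1 / q)).aemeasurable
      (hf.mul ((hκx x).pow_const (1 / p))).aemeasurable
    have e1 : ∀ y, (κ x y ^ (1 / q)) ^ q = κ x y := fun y => by
      rw [← ENNReal.rpow_mul, one_div_mul_cancel hq0.ne', ENNReal.rpow_one]
    have e2 : ∀ y, (f y * κ x y ^ (1 / p)) ^ p = f y ^ p * κ x y := fun y => by
      rw [ENNReal.mul_rpow_of_nonneg _ _ hp0.le, ← ENNReal.rpow_mul, one_div_mul_cancel hp0.ne',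
        ENNReal.rpow_one]
    simp only [e1, Pi.mul_apply, e2] at hh
    calc (∫⁻ y, f y * κ x y ∂ν) ^ p
        = (∫⁻ y, κ x y ^ (1 / q) * (f y * κ x y ^ (1 / p)) ∂ν) ^ p := by
          simp only [hsplit, Pi.mul_apply]
      _ ≤ ((∫⁻ y, κ x y ∂ν) ^ (1 / q) * (∫⁻ y, f y ^ p * κ x y ∂ν) ^ (1 / p)) ^ p := by
          gcongr
      _ = (∫⁻ y, κ x y ∂ν) ^ (p - 1) * ∫⁻ y, f y ^ p * κ x y ∂ν := by
          rw [ENNReal.mul_rpow_of_nonneg _ _ hp0.le, ← ENNReal.rpow_mul, ← ENNReal.rpow_mul,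
            one_div_mul_cancel hp0.ne', ENNReal.rpow_one]
          congr 2
          rw [one_div, inv_mul_eq_div, hpq.div_conj_eq_sub_one]
  calc ∫⁻ x, (∫⁻ y, f y * κ x y ∂ν) ^ p ∂μ
      ≤ ∫⁻ x, A ^ (p - 1) * ∫⁻ y, f y ^ p * κ x y ∂ν ∂μ := by
        refine lintegral_mono_ae ?_
        filter_upwards [h1] with x hx
        refine (hrow x).trans ?_
        gcongr
        exact hpq.sub_one_pos.le
    _ = A ^ (p - 1) * ∫⁻ y, f y ^ p * ∫⁻ x, κ x y ∂μ ∂ν := by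
        have hm : Measurable (Function.uncurry fun x y => f y ^ p * κ x y) :=
          ((hf.comp measurable_snd).pow_const p).mul hκ
        have hm' : Measurable fun x => ∫⁻ y, f y ^ p * κ x y ∂ν := hm.lintegral_prod_right'
        rw [lintegral_const_mul _ hm', lintegral_lintegral_swap hm.aemeasurable]
        congr 1
        refine lintegral_congr fun y => ?_
        rw [lintegral_const_mul]
        exact hκ.comp measurable_prodMk_right
    _ ≤ A ^ (p - 1) * ∫⁻ y, f y ^ p * A ∂ν := by
        gcongr with y; exact h2 y
    _ = A ^ p * ∫⁻ y, f y ^ p ∂ν := by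
        rw [lintegral_mul_const _ (hf.pow_const p), mul_left_comm, mul_comm]
        congr 1
        conv_lhs => rw [← ENNReal.rpow_one A]
        rw [← ENNReal.rpow_mul, one_mul,
          ← ENNReal.rpow_add_of_nonneg _ _ hpq.sub_one_pos.le zero_le_one, sub_add_cancel]

/-! ### The representation kernel -/

namespace Setting

variable {n m : ℕ} (S : Setting n m)

/-- The pairs of points of `Ω₀` at distance less than `s`. -/
def nearPairs (s : ℝ) : Set (E n × E n) :=
  {z ∈ S.Ω₀ ×ˢ S.Ω₀ | ccDist S.Ω₀ S.X z.1 z.2 < ENNReal.ofReal s}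

/-- `s` times the kernel of the averaging operator `f ↦ |B(x, s)|⁻¹ ∫_{B(x, s)} f`. It is written
through `nearPairs`, which makes it jointly measurable on `ℝⁿ × ℝⁿ`. -/
noncomputable def avgKernel (s : ℝ) (x y : E n) : ℝ≥0∞ :=
  (S.nearPairs s).indicator (fun _ => ENNReal.ofReal s) (x, y) *
    (volume (Prod.mk x ⁻¹' S.nearPairs s))⁻¹

/-- A dyadic sum of averaging kernels dominating `d(x, y) / |B(x, d(x, y))|` when `d(x, y) < R`. -/
noncomputable def dyadicKernel (R : ℝ) (x y : E n) : ℝ≥0∞ :=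
  ∑' k : ℕ, S.avgKernel (R / 2 ^ k) x y

/-- The doubling inequality at `x`, with constant `C`, up to the radius `r₀`. -/
def DoublingAt (x : E n) (r₀ C : ℝ) : Prop :=
  ∀ r : ℝ, 0 < r → r < r₀ → volume (ccBall S.Ω₀ S.X x (ENNReal.ofReal (2 * r))) ≤
    ENNReal.ofReal C * volume (ccBall S.Ω₀ S.X x (ENNReal.ofReal r))

variable {S}

theorem H1.isOpen_nearPairs (h : S.H1) (s : ℝ) : IsOpen (S.nearPairs s) :=
  h.2.isOpen_inter_preimage (S.isOpen'.prod S.isOpen') isOpen_Iio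

theorem preimage_nearPairs {x : E n} (hx : x ∈ S.Ω₀) (s : ℝ) :
    Prod.mk x ⁻¹' S.nearPairs s = ccBall S.Ω₀ S.X x (ENNReal.ofReal s) := by
  ext y
  simp [nearPairs, ccBall, hx]

theorem H1.isOpen_ccBall (h : S.H1) {x : E n} (hx : x ∈ S.Ω₀) (s : ℝ) :
    IsOpen (ccBall S.Ω₀ S.X x (ENNReal.ofReal s)) := by
  rw [← preimage_nearPairs hx]
  exact (h.isOpen_nearPairs s).preimage (Continuous.prodMk_right x)

theorem mem_ccBall_self {x : E n} (hx : x ∈ S.Ω₀) {s : ℝ} (hs : 0 < s) :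
    x ∈ ccBall S.Ω₀ S.X x (ENNReal.ofReal s) :=
  ⟨hx, by rw [ccDist_self hx]; simpa⟩

theorem H1.measurable_avgKernel (h : S.H1) (s : ℝ) :
    Measurable (Function.uncurry (S.avgKernel s)) := by
  have hm := (h.isOpen_nearPairs s).measurableSet
  exact (measurable_const.indicator hm).mul
    ((measurable_measure_prodMk_left hm).comp measurable_fst).inv

theorem H1.measurable_dyadicKernel (h : S.H1) (R : ℝ) :
    Measurable (Function.uncurry (S.dyadicKernel R)) := by
  have : Function.uncurry (S.dyadicKernel R) =
      fun z => ∑' k : ℕ, Function.uncurry (S.avgKernel (R / 2 ^ k)) z := by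
    funext z; rfl
  rw [this]
  exact Measurable.tsum fun k => h.measurable_avgKernel _

theorem tsum_ofReal_dyadic {R : ℝ} (hR : 0 ≤ R) :
    ∑' k : ℕ, ENNReal.ofReal (R / 2 ^ k) = ENNReal.ofReal (2 * R) := by
  have hs : HasSum (fun k : ℕ => R / 2 ^ k) (2 * R) := by
    have := hasSum_geometric_two.mul_left R
    convert! this using 1
    · funext k; rw [one_div, inv_pow, div_eq_mul_inv]
    · ring
  rw [← hs.tsum_eq, ENNReal.ofReal_tsum_of_nonneg (fun k => by positivity) hs.summable]

theorem H1.lintegral_avgKernel_right (h : S.H1) (s : ℝ) (x : E n) :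
    ∫⁻ y, S.avgKernel s x y ≤ ENNReal.ofReal s := by
  have hm : MeasurableSet (Prod.mk x ⁻¹' S.nearPairs s) :=
    measurable_prodMk_left (h.isOpen_nearPairs s).measurableSet
  have e : ∀ y, S.avgKernel s x y = (Prod.mk x ⁻¹' S.nearPairs s).indicator
      (fun _ => ENNReal.ofReal s * (volume (Prod.mk x ⁻¹' S.nearPairs s))⁻¹) y := fun y => by
    by_cases hy : y ∈ Prod.mk x ⁻¹' S.nearPairs s
    · rw [indicator_of_mem hy, avgKernel, indicator_of_mem (by exact hy)]
    · rw [indicator_of_notMem hy, avgKernel, indicator_of_notMem (by exact hy), zero_mul]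
  simp only [e, lintegral_indicator hm, setLIntegral_const]
  rw [mul_assoc]
  exact mul_le_of_le_one_right' (by rw [mul_comm]; exact ENNReal.mul_inv_le_one _)

theorem DoublingAt.inv_le {x : E n} {r₀ C r : ℝ} (hd : S.DoublingAt x r₀ C) (hC : 0 < C)
    (hr : 0 < r) (hr₀ : r < r₀) :
    (volume (ccBall S.Ω₀ S.X x (ENNReal.ofReal r)))⁻¹ ≤
      ENNReal.ofReal C * (volume (ccBall S.Ω₀ S.X x (ENNReal.ofReal (2 * r))))⁻¹ := by
  have hC0 : ENNReal.ofReal C ≠ 0 := by simpa using hC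
  have h := ENNReal.inv_le_inv.2 (hd r hr hr₀)
  rw [ENNReal.mul_inv (Or.inl hC0) (Or.inl ENNReal.ofReal_ne_top)] at h
  calc (volume (ccBall S.Ω₀ S.X x (ENNReal.ofReal r)))⁻¹
      = ENNReal.ofReal C * ((ENNReal.ofReal C)⁻¹ *
          (volume (ccBall S.Ω₀ S.X x (ENNReal.ofReal r)))⁻¹) := by
        rw [← mul_assoc, ENNReal.mul_inv_cancel hC0 ENNReal.ofReal_ne_top, one_mul]
    _ ≤ _ := by gcongr

/-- The column integrals of the averaging kernel. For `x` at distance less than `s` from `y`, the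
ball `B(y, s)` lies in `B(x, 2s)`, so that `|B(x, s)|` is at least a multiple of `|B(y, s)|`. -/
theorem H1.lintegral_avgKernel_left (h : S.H1) {K : Set (E n)} (hKm : MeasurableSet K)
    (hKΩ : K ⊆ S.Ω₀) {r₀ C s : ℝ} (hC : 0 < C) (hd : ∀ x ∈ K, S.DoublingAt x r₀ C)
    (hs : 0 < s) (hs₀ : s < r₀) (y : E n) :
    ∫⁻ x in K, S.avgKernel s x y ≤ ENNReal.ofReal C * ENNReal.ofReal s := by
  set B := ccBall S.Ω₀ S.X y (ENNReal.ofReal s) with hB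
  by_cases hy : y ∈ S.Ω₀
  · have hBm : MeasurableSet B := (h.isOpen_ccBall hy s).measurableSet
    have hle : ∀ x ∈ K, S.avgKernel s x y ≤
        B.indicator (fun _ => ENNReal.ofReal C * ENNReal.ofReal s * (volume B)⁻¹) x := by
      intro x hx
      have hxΩ := hKΩ hx
      by_cases hxy : ccDist S.Ω₀ S.X x y < ENNReal.ofReal s
      · have hxB : x ∈ B := ⟨hxΩ, by rwa [ccDist_comm]⟩
        have hmem : (x, y) ∈ S.nearPairs s := ⟨⟨hxΩ, hy⟩, hxy⟩
        rw [indicator_of_mem hxB, avgKernel, indicator_of_mem hmem, preimage_nearPairs hxΩ]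
        have hsub : B ⊆ ccBall S.Ω₀ S.X x (ENNReal.ofReal (2 * s)) := fun z hz => by
          refine ⟨hz.1, (ccDist_triangle x y z).trans_lt ?_⟩
          rw [two_mul, ENNReal.ofReal_add hs.le hs.le]
          exact ENNReal.add_lt_add hxy hz.2
        calc ENNReal.ofReal s * (volume (ccBall S.Ω₀ S.X x (ENNReal.ofReal s)))⁻¹
            ≤ ENNReal.ofReal s * (ENNReal.ofReal C *
                (volume (ccBall S.Ω₀ S.X x (ENNReal.ofReal (2 * s))))⁻¹) := by
              gcongr; exact (hd x hx).inv_le hC hs hs₀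
          _ ≤ ENNReal.ofReal s * (ENNReal.ofReal C * (volume B)⁻¹) := by gcongr
          _ = _ := by ring
      · have hmem : (x, y) ∉ S.nearPairs s := fun hm => hxy hm.2
        rw [avgKernel, indicator_of_notMem hmem, zero_mul]
        exact zero_le
    calc ∫⁻ x in K, S.avgKernel s x y
        ≤ ∫⁻ x in K, B.indicator
            (fun _ => ENNReal.ofReal C * ENNReal.ofReal s * (volume B)⁻¹) x :=
          setLIntegral_mono' hKm hle
      _ ≤ ∫⁻ x, B.indicator (fun _ => ENNReal.ofReal C * ENNReal.ofReal s * (volume B)⁻¹) x :=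
          setLIntegral_le_lintegral _ _
      _ ≤ ENNReal.ofReal C * ENNReal.ofReal s := by
          rw [lintegral_indicator hBm, setLIntegral_const, mul_assoc]
          exact mul_le_of_le_one_right' (by rw [mul_comm]; exact ENNReal.mul_inv_le_one _)
  · have : ∀ x, S.avgKernel s x y = 0 := fun x => by
      rw [avgKernel, indicator_of_notMem (fun hm => hy hm.1.2), zero_mul]
    simp [this]

/-- The kernel of the representation formula is dominated by the dyadic sum of averaging kernels:
if `d(x, y) = δ` with `R / 2^(k+1) ≤ δ < R / 2^k`, then `δ / |B(x, δ)|` is at most a multiple of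
`(R / 2^k) / |B(x, R / 2^k)|`. At `δ = 0` the quotient is `0`, since `B(x, 0) = ∅`. -/
theorem ccDist_div_volume_le {x y : E n} (hx : x ∈ S.Ω₀) (hy : y ∈ S.Ω₀) {r₀ C R : ℝ}
    (hC : 0 < C) (hd : S.DoublingAt x r₀ C) (hR : R < r₀)
    (hxy : ccDist S.Ω₀ S.X x y < ENNReal.ofReal R) :
    ccDist S.Ω₀ S.X x y / volume (ccBall S.Ω₀ S.X x (ccDist S.Ω₀ S.X x y)) ≤
      ENNReal.ofReal C * S.dyadicKernel R x y := by
  have hRpos : 0 < R := ENNReal.ofReal_pos.1 ((zero_le).trans_lt hxy)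
  set D := ccDist S.Ω₀ S.X x y with hD
  have hDtop : D ≠ ∞ := hxy.ne_top
  obtain ⟨δ, hδ0, hδ⟩ : ∃ δ : ℝ, 0 ≤ δ ∧ D = ENNReal.ofReal δ :=
    ⟨D.toReal, ENNReal.toReal_nonneg, (ENNReal.ofReal_toReal hDtop).symm⟩
  rw [hδ] at hxy ⊢
  have hδR : δ < R := (ENNReal.ofReal_lt_ofReal_iff hRpos).1 hxy
  rcases hδ0.eq_or_lt with rfl | hδpos
  · simp
  have hex : ∃ k : ℕ, R / 2 ^ (k + 1) ≤ δ := by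
    obtain ⟨k, hk⟩ := exists_pow_lt_of_lt_one (div_pos hδpos hRpos) (by norm_num : (1 / 2 : ℝ) < 1)
    refine ⟨k, ?_⟩
    rw [lt_div_iff₀ hRpos, one_div, inv_pow, inv_mul_eq_div] at hk
    refine le_trans ?_ hk.le
    gcongr <;> norm_num
  classical
  set k := Nat.find hex with hk
  have hk1 : R / 2 ^ (k + 1) ≤ δ := Nat.find_spec hex
  have hk2 : δ < R / 2 ^ k := by
    rcases Nat.eq_zero_or_pos k with h0 | h0
    · rw [h0]; simpa using hδR
    · have := Nat.find_min hex (m := k - 1) (by omega)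
      rwa [not_le, Nat.sub_add_cancel h0] at this
  have hs : 2 * (R / 2 ^ (k + 1)) = R / 2 ^ k := by rw [pow_succ]; field_simp
  have hs₀ : R / 2 ^ (k + 1) < r₀ := lt_of_le_of_lt hk1 (hδR.trans hR)
  have hmem : (x, y) ∈ S.nearPairs (R / 2 ^ k) := by
    refine ⟨⟨hx, hy⟩, ?_⟩
    change D < _
    rw [hδ]
    exact (ENNReal.ofReal_lt_ofReal_iff (by positivity)).2 hk2
  calc ENNReal.ofReal δ / volume (ccBall S.Ω₀ S.X x (ENNReal.ofReal δ))
      ≤ ENNReal.ofReal (R / 2 ^ k) *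
          (volume (ccBall S.Ω₀ S.X x (ENNReal.ofReal (R / 2 ^ (k + 1)))))⁻¹ := by
        rw [div_eq_mul_inv]
        gcongr
        exact fun z hz => ⟨hz.1, hz.2.trans_le (ENNReal.ofReal_le_ofReal hk1)⟩
    _ ≤ ENNReal.ofReal (R / 2 ^ k) * (ENNReal.ofReal C *
          (volume (ccBall S.Ω₀ S.X x (ENNReal.ofReal (R / 2 ^ k))))⁻¹) := by
        gcongr
        have := hd.inv_le hC (r := R / 2 ^ (k + 1)) (by positivity) hs₀
        rwa [hs] at this
    _ = ENNReal.ofReal C * S.avgKernel (R / 2 ^ k) x y := by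
        rw [avgKernel, indicator_of_mem hmem, preimage_nearPairs hx]; ring
    _ ≤ ENNReal.ofReal C * S.dyadicKernel R x y := by
        gcongr
        exact ENNReal.le_tsum (f := fun k : ℕ => S.avgKernel (R / 2 ^ k) x y) k

/-- The operator with the dyadic kernel on scale `R` has norm `O(R)` from `L^p` to `L^p(K)`. -/
theorem H1.eLpNorm_dyadicKernel_le (h : S.H1) {p q : ℝ≥0∞} (hp : p ≠ ∞) (hp0 : p ≠ 0)
    (hpq : p.toReal.HolderConjugate q.toReal) {K : Set (E n)} (hKm : MeasurableSet K)
    (hKΩ : K ⊆ S.Ω₀) {r₀ C R : ℝ} (hC : 0 < C) (hd : ∀ x ∈ K, S.DoublingAt x r₀ C)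
    (hR : 0 < R) (hR₀ : R < r₀) {f : E n → ℝ≥0∞} (hf : Measurable f) :
    eLpNorm (fun x => ∫⁻ y, f y * S.dyadicKernel R x y) p (volume.restrict K) ≤
      ENNReal.ofReal ((1 + C) * (2 * R)) * eLpNorm f p volume := by
  have hrow : ∀ x, ∫⁻ y, S.dyadicKernel R x y ≤ ENNReal.ofReal ((1 + C) * (2 * R)) := fun x => by
    have hm : ∀ k : ℕ, Measurable (S.avgKernel (R / 2 ^ k) x) := fun k =>
      (h.measurable_avgKernel _).comp measurable_prodMk_left
    simp only [dyadicKernel]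
    rw [lintegral_tsum fun k => (hm k).aemeasurable]
    calc ∑' k : ℕ, ∫⁻ y, S.avgKernel (R / 2 ^ k) x y ≤ ∑' k : ℕ, ENNReal.ofReal (R / 2 ^ k) :=
          ENNReal.tsum_le_tsum fun k => h.lintegral_avgKernel_right _ x
      _ = ENNReal.ofReal (2 * R) := tsum_ofReal_dyadic hR.le
      _ ≤ _ := ENNReal.ofReal_le_ofReal (by nlinarith)
  have hcol : ∀ y, ∫⁻ x in K, S.dyadicKernel R x y ≤ ENNReal.ofReal ((1 + C) * (2 * R)) :=
    fun y => by
    have hm : ∀ k : ℕ, Measurable (fun x => S.avgKernel (R / 2 ^ k) x y) := fun k =>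
      (h.measurable_avgKernel _).comp measurable_prodMk_right
    simp only [dyadicKernel]
    rw [lintegral_tsum fun k => (hm k).aemeasurable]
    calc ∑' k : ℕ, ∫⁻ x in K, S.avgKernel (R / 2 ^ k) x y
        ≤ ∑' k : ℕ, ENNReal.ofReal C * ENNReal.ofReal (R / 2 ^ k) :=
          ENNReal.tsum_le_tsum fun k => h.lintegral_avgKernel_left hKm hKΩ hC hd (by positivity)
            (lt_of_le_of_lt (div_le_self hR.le (one_le_pow₀ (by norm_num))) hR₀) y
      _ = ENNReal.ofReal (C * (2 * R)) := by
          rw [ENNReal.tsum_mul_left, tsum_ofReal_dyadic hR.le, ENNReal.ofReal_mul hC.le]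
      _ ≤ _ := ENNReal.ofReal_le_ofReal (by nlinarith)
  have hpos : 0 < p.toReal := hpq.pos
  rw [eLpNorm_eq_lintegral_rpow_enorm_toReal hp0 hp, eLpNorm_eq_lintegral_rpow_enorm_toReal hp0 hp]
  simp only [enorm_eq_self]
  calc (∫⁻ x in K, (∫⁻ y, f y * S.dyadicKernel R x y) ^ p.toReal) ^ (1 / p.toReal)
      ≤ (ENNReal.ofReal ((1 + C) * (2 * R)) ^ p.toReal * ∫⁻ y, f y ^ p.toReal) ^
          (1 / p.toReal) := by
        gcongr
        exact lintegral_schur hpq (h.measurable_dyadicKernel R) hf (Eventually.of_forall hrow) hcol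
    _ = _ := by
        rw [ENNReal.mul_rpow_of_nonneg _ _ (by positivity), ← ENNReal.rpow_mul,
          mul_one_div_cancel hpos.ne', ENNReal.rpow_one]

end Setting

end XGrad

namespace XGrad

namespace Setting

variable {n m : ℕ} {S : Setting n m}

/-! ### A Poincaré-type estimate for test functions -/

/-- On a compact set, the `L^p` norm of a test function is controlled by a small multiple of the
norm of its `X`-gradient and by finitely many of its averages. The set is covered by finitely many
balls of small radius `r`, and on each of them the representation formula is integrated by means of
the dyadic kernel, whose norm is `O(r)`. -/
theorem exists_eLpNorm_le_of_isTest (h1 : S.H1) (h2 : S.H2) (h3 : S.H3) {p q : ℝ≥0∞}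
    (hp : p ≠ ∞) (hp1 : 1 ≤ p) (hpq : p.toReal.HolderConjugate q.toReal) {K : Set (E n)}
    (hK : IsCompact K) (hKΩ : K ⊆ S.Ω₀) {ε : ℝ} (hε : 0 < ε) :
    ∃ (t : Finset (E n)) (B : E n → Set (E n)) (D : ℝ≥0), (∀ a ∈ t, MeasurableSet (B a)) ∧
      ∀ ψ : E n → ℝ, S.IsTest 1 ψ → eLpNorm ψ p (volume.restrict K) ≤
        ENNReal.ofReal ε * eLpNorm (pointGrad S.X ψ) p volume +
          D * ∑ a ∈ t, ‖∫ x in B a, ψ x‖ₑ := by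
  have hp0 : p ≠ 0 := (zero_lt_one.trans_le hp1).ne'
  obtain ⟨c, hc, C, hC, hrep⟩ := h3
  obtain ⟨r₀, hr₀, C', hC', hd⟩ := h2 K hK hKΩ
  obtain ⟨δ, hδ, hcl⟩ := S.exists_closure_ccBall_subset hK hKΩ
  -- The scale: small enough for the representation formula, for doubling, and for the factor `ε`.
  obtain ⟨r, hr, hr1, hr2, hr3⟩ : ∃ r > (0 : ℝ), c * r ≤ δ ∧ (1 + c) * r < r₀ ∧
      C * C' * ((1 + C') * (2 * ((1 + c) * r))) ≤ ε := by
    refine ⟨min (δ / c) (min (r₀ / (1 + c) / 2) (ε / (C * C' * ((1 + C') * (2 * (1 + c)))))),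
      by positivity, ?_, ?_, ?_⟩
    · calc c * min (δ / c) _ ≤ c * (δ / c) := by gcongr; exact min_le_left _ _
        _ = δ := by field_simp
    · calc (1 + c) * min (δ / c) (min (r₀ / (1 + c) / 2) _)
          ≤ (1 + c) * (r₀ / (1 + c) / 2) := by
            gcongr; exact (min_le_right _ _).trans (min_le_left _ _)
        _ = r₀ / 2 := by field_simp
        _ < r₀ := by linarith
    · set F := C * C' * ((1 + C') * (2 * (1 + c))) with hF
      have hF0 : 0 < F := by positivity
      calc C * C' * ((1 + C') * (2 * ((1 + c) * min (δ / c) (min (r₀ / (1 + c) / 2) (ε / F)))))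
          = F * min (δ / c) (min (r₀ / (1 + c) / 2) (ε / F)) := by rw [hF]; ring
        _ ≤ F * (ε / F) := by gcongr; exact (min_le_right _ _).trans (min_le_right _ _)
        _ = ε := by field_simp
  set R : ℝ := (1 + c) * r with hRdef
  have hR : 0 < R := by positivity
  set B : E n → Set (E n) := fun a => ccBall S.Ω₀ S.X a (ENNReal.ofReal r) with hB
  obtain ⟨t, htK, htcov⟩ := hK.elim_nhds_subcover B fun a ha =>
    (h1.isOpen_ccBall (hKΩ ha) r).mem_nhds (mem_ccBall_self (hKΩ ha) hr)
  have hKm := hK.measurableSet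
  set V : ℝ≥0∞ := (volume.restrict K) univ ^ (1 / p.toReal) with hV
  have hVtop : V ≠ ∞ := by
    refine (ENNReal.rpow_lt_top_of_nonneg (by positivity) ?_).ne
    rw [Measure.restrict_apply_univ]; exact hK.measure_lt_top.ne
  set w : E n → ℝ≥0 := fun a => ‖(volume.real (B a))⁻¹‖₊ with hw
  refine ⟨t, B, V.toNNReal * ∑ a ∈ t, w a,
    fun a ha => (h1.isOpen_ccBall (hKΩ (htK a ha)) r).measurableSet, fun ψ hψ => ?_⟩
  obtain ⟨L, hL⟩ := hψ.exists_lipschitzWith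
  set f : E n → ℝ≥0∞ := fun y => ‖pointGrad S.X ψ y‖ₑ with hf
  have hfm : Measurable f := hψ.continuous_pointGrad.enorm.measurable
  set Tf : E n → ℝ≥0∞ := fun x => ∫⁻ y, f y * S.dyadicKernel R x y with hTf
  have hTfm : Measurable Tf := by
    have : Measurable (Function.uncurry fun x y => f y * S.dyadicKernel R x y) :=
      (hfm.comp measurable_snd).mul (h1.measurable_dyadicKernel R)
    exact this.lintegral_prod_right'
  set G : ℝ≥0∞ := (∑ a ∈ t, w a : ℝ≥0) * ∑ a ∈ t, ‖∫ x in B a, ψ x‖ₑ with hG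
  have hpt : ∀ x ∈ K, ‖ψ x‖ₑ ≤ ENNReal.ofReal (C * C') * Tf x + G := by
    intro x hx
    obtain ⟨a, ha, hxa⟩ : ∃ a ∈ t, x ∈ B a := by simpa using htcov hx
    have hxΩ := hKΩ hx
    have haΩ := hKΩ (htK a ha)
    have e1 : ENNReal.ofReal |ψ x - ⨍ y in B a, ψ y| ≤ ENNReal.ofReal (C * C') * Tf x := by
      refine (hrep a haΩ r hr (hcl a (htK a ha) _ hr1) ψ ⟨L, hL.lipschitzOnWith⟩ x
        (subset_closure hxa)).trans ?_
      rw [ENNReal.ofReal_mul hC.le, mul_assoc]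
      gcongr
      rw [hTf, ← lintegral_const_mul']
      swap; · exact ENNReal.ofReal_ne_top
      refine (setLIntegral_mono' (h1.isOpen_ccBall haΩ _).measurableSet fun y hy => ?_).trans
        (setLIntegral_le_lintegral _ _)
      rw [mul_left_comm]
      refine mul_le_mul_right (ccDist_div_volume_le hxΩ hy.1 hC' (hd x hx) hr2 ?_) _
      calc ccDist S.Ω₀ S.X x y ≤ ccDist S.Ω₀ S.X x a + ccDist S.Ω₀ S.X a y := ccDist_triangle _ _ _
        _ < ENNReal.ofReal r + ENNReal.ofReal (c * r) :=
          ENNReal.add_lt_add (by rw [ccDist_comm]; exact hxa.2) hy.2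
        _ = ENNReal.ofReal R := by
          rw [← ENNReal.ofReal_add hr.le (by positivity), hRdef]; congr 1; ring
    have e2 : ‖⨍ y in B a, ψ y‖ₑ ≤ G := by
      rw [setAverage_eq, enorm_smul, hG]
      gcongr
      · have h := Finset.single_le_sum (f := w) (fun _ _ => zero_le) ha
        exact_mod_cast h
      · exact Finset.single_le_sum (f := fun a => ‖∫ x in B a, ψ x‖ₑ) (fun _ _ => zero_le) ha
    calc ‖ψ x‖ₑ = ‖(ψ x - ⨍ y in B a, ψ y) + ⨍ y in B a, ψ y‖ₑ := by rw [sub_add_cancel]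
      _ ≤ ‖ψ x - ⨍ y in B a, ψ y‖ₑ + ‖⨍ y in B a, ψ y‖ₑ := enorm_add_le _ _
      _ ≤ _ := by
        gcongr
        rwa [Real.enorm_eq_ofReal_abs]
  have hTfle : eLpNorm (fun x => ENNReal.ofReal (C * C') * Tf x) p (volume.restrict K) ≤
      ENNReal.ofReal ε * eLpNorm (pointGrad S.X ψ) p volume := by
    have hfn : eLpNorm f p volume = eLpNorm (pointGrad S.X ψ) p volume := by
      rw [hf, eLpNorm_eq_lintegral_rpow_enorm_toReal hp0 hp,
        eLpNorm_eq_lintegral_rpow_enorm_toReal hp0 hp]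
      simp only [enorm_eq_self]
    calc eLpNorm (fun x => ENNReal.ofReal (C * C') * Tf x) p (volume.restrict K)
        ≤ ENNReal.ofReal (C * C') * eLpNorm Tf p (volume.restrict K) :=
          eLpNorm_le_mul_eLpNorm_of_ae_le_mul' (c := (C * C').toNNReal)
            (Eventually.of_forall fun x => le_rfl) p
      _ ≤ ENNReal.ofReal (C * C') *
          (ENNReal.ofReal ((1 + C') * (2 * R)) * eLpNorm f p volume) := by
          gcongr
          exact h1.eLpNorm_dyadicKernel_le hp hp0 hpq hKm hKΩ hC' hd hR hr2 hfm
      _ = ENNReal.ofReal (C * C' * ((1 + C') * (2 * R))) * eLpNorm (pointGrad S.X ψ) p volume := by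
          rw [hfn, ← mul_assoc, ENNReal.ofReal_mul (p := C * C') (by positivity)]
      _ ≤ _ := by gcongr
  have hGV : eLpNorm (fun _ : E n => G) p (volume.restrict K) ≤ G * V := by
    rcases eq_or_ne (volume.restrict K) 0 with h0 | h0
    · simp [h0]
    · rw [eLpNorm_const _ hp0 h0, enorm_eq_self]
  calc eLpNorm ψ p (volume.restrict K)
      ≤ eLpNorm ((fun x => ENNReal.ofReal (C * C') * Tf x) + fun _ => G) p (volume.restrict K) := by
        refine eLpNorm_mono_enorm_ae ((ae_restrict_iff' hKm).2 (Eventually.of_forall fun x hx => ?_))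
        simpa using hpt x hx
    _ ≤ eLpNorm (fun x => ENNReal.ofReal (C * C') * Tf x) p (volume.restrict K) +
          eLpNorm (fun _ : E n => G) p (volume.restrict K) :=
        eLpNorm_add_le (hTfm.const_mul _).aestronglyMeasurable
          aestronglyMeasurable_const hp1
    _ ≤ ENNReal.ofReal ε * eLpNorm (pointGrad S.X ψ) p volume + G * V := add_le_add hTfle hGV
    _ = _ := by
        rw [hG, ENNReal.coe_mul, ENNReal.coe_toNNReal hVtop]; ring

end Setting

end XGrad

namespace XGrad

/-! ### Weak convergence and compactness in `V` -/

theorem WeakTendsto.exists_norm_le {Y : Type*} [NormedAddCommGroup Y] [NormedSpace ℝ Y]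
    {y : ℕ → Y} {y₀ : Y} (h : WeakTendsto y y₀) : ∃ C, ∀ k, ‖y k‖ ≤ C := by
  obtain ⟨C, hC⟩ := banach_steinhaus (g := fun k => NormedSpace.inclusionInDoubleDual ℝ Y (y k))
    fun f => by
      obtain ⟨C, hC⟩ := (h f).norm.bddAbove_range
      exact ⟨C, fun k => hC ⟨k, rfl⟩⟩
  exact ⟨C, fun k => by
    rw [← (NormedSpace.inclusionInDoubleDualLi (E := Y) ℝ).norm_map (y k)]; exact hC k⟩

/-- A bounded bilinear form converges along a strongly and a weakly convergent sequence. -/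
theorem WeakTendsto.tendsto_bilin {Y Z : Type*} [NormedAddCommGroup Y] [NormedSpace ℝ Y]
    [NormedAddCommGroup Z] [NormedSpace ℝ Z] (B : Y →L[ℝ] Z →L[ℝ] ℝ) {y : ℕ → Y} {y₀ : Y}
    {z : ℕ → Z} {z₀ : Z} (hy : Tendsto y atTop (𝓝 y₀)) (hz : WeakTendsto z z₀) :
    Tendsto (fun k => B (y k) (z k)) atTop (𝓝 (B y₀ z₀)) := by
  obtain ⟨C, hC⟩ := hz.exists_norm_le
  have h0 : Tendsto (fun k => B (y k - y₀) (z k)) atTop (𝓝 0) := by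
    refine squeeze_zero_norm (fun k => ?_) (by
      simpa only [mul_zero, zero_mul] using
        ((tendsto_iff_norm_sub_tendsto_zero.1 hy).const_mul ‖B‖).mul_const C)
    exact (B.le_opNorm₂ _ _).trans (by gcongr; exact hC k)
  have h1 := h0.add (hz (B y₀))
  rw [zero_add] at h1
  refine h1.congr fun k => ?_
  rw [map_sub, sub_apply, sub_add_cancel]

theorem toReal_le_of_le_enorm {ι G : Type*} [SeminormedAddCommGroup G] {x : ℝ≥0∞} {ε : ℝ}
    (hε : 0 ≤ ε) (g : G) {D : ℝ≥0} {t : Finset ι} {f : ι → ℝ}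
    (h : x ≤ ENNReal.ofReal ε * ‖g‖ₑ + D * ∑ a ∈ t, ‖f a‖ₑ) :
    x.toReal ≤ ε * ‖g‖ + D * ∑ a ∈ t, ‖f a‖ := by
  refine ENNReal.toReal_le_of_le_ofReal (by positivity) (h.trans_eq ?_)
  rw [ENNReal.ofReal_add (by positivity) (by positivity), ENNReal.ofReal_mul hε,
    ENNReal.ofReal_mul (NNReal.coe_nonneg D), ENNReal.ofReal_sum_of_nonneg fun _ _ => norm_nonneg _,
    ENNReal.ofReal_coe_nnreal]
  simp only [ofReal_norm]

namespace Setting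

variable {n m : ℕ} {S : Setting n m}

theorem exists_setIntegral_clm {p q : ℝ≥0∞} [Fact (1 ≤ p)] [Fact (1 ≤ q)] [p.HolderConjugate q]
    {B : Set (E n)} (hB : MeasurableSet B) :
    ∃ ℓ : Lp ℝ p S.μ →L[ℝ] ℝ, ∀ f : Lp ℝ p S.μ, ℓ f = ∫ x in B, f x ∂S.μ := by
  refine ⟨((ContinuousLinearMap.mul ℝ ℝ).lpPairing S.μ p q).flip
    (indicatorConstLp q hB (measure_ne_top S.μ B) (1 : ℝ)), fun f => ?_⟩
  rw [ContinuousLinearMap.flip_apply, ContinuousLinearMap.lpPairing_eq_integral,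
    ← integral_indicator hB]
  refine integral_congr_ae ?_
  filter_upwards [indicatorConstLp_coeFn (p := q) (hs := hB) (hμs := measure_ne_top S.μ B)
    (c := (1 : ℝ))] with x hx
  rw [ContinuousLinearMap.mul_apply', hx]
  by_cases h : x ∈ B <;> simp [h]

/-- For an element of `C¹_c(Ω) ∩ W^{1,p}_X(Ω)`, the recorded gradient is the pointwise one. -/
theorem snd_ae_eq_pointGrad {p : ℝ≥0∞} [Fact (1 ≤ p)] (z : S.W p) {φ : E n → ℝ}
    (hφ : S.IsTest 1 φ) (h : z.1.fst =ᵐ[S.μ] φ) : z.1.snd =ᵐ[S.μ] pointGrad S.X φ := by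
  have hz : S.IsXGrad φ z.1.snd := fun j η hη => by
    rw [← z.2 j η hη]
    refine integral_congr_ae ?_
    filter_upwards [h] with x hx
    rw [hx]
  exact hz.ae_eq hφ.isXGrad ((Lp.memLp _).integrable Fact.out)
    (hφ.continuous_pointGrad.integrable_of_hasCompactSupport
      hφ.hasCompactSupport_pointGrad).integrableOn

/-- The estimate `exists_eLpNorm_le_of_isTest` extended to `V` by density. -/
theorem exists_norm_restrict_le (h1 : S.H1) (h2 : S.H2) (h3 : S.H3) {p q : ℝ≥0∞} [Fact (1 ≤ p)]
    [Fact (1 ≤ q)] [p.HolderConjugate q] (hp : p ≠ ∞) (hp1 : 1 < p) {K : Set (E n)}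
    (hK : IsCompact K) (hKΩ : K ⊆ S.Ω) {ε : ℝ} (hε : 0 < ε) :
    ∃ (t : Finset (E n)) (ℓ : E n → Lp ℝ p S.μ →L[ℝ] ℝ) (D : ℝ), ∀ z : S.V p,
      ‖LpToLpRestrictCLM (E n) ℝ ℝ S.μ p K z.1.1.fst‖ ≤
        ε * ‖z‖ + D * ∑ a ∈ t, ‖ℓ a z.1.1.fst‖ := by
  have hpq : p.toReal.HolderConjugate q.toReal := ENNReal.HolderConjugate.toReal (by
    rw [← ENNReal.toReal_one]
    exact (ENNReal.toReal_lt_toReal ENNReal.one_ne_top hp).2 hp1)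
  obtain ⟨t, B, D, hB, hest⟩ := exists_eLpNorm_le_of_isTest h1 h2 h3 hp hp1.le hpq hK
    (hKΩ.trans S.subset_Ω₀) hε
  have hℓ : ∀ a, ∃ ℓ : Lp ℝ p S.μ →L[ℝ] ℝ, a ∈ t → ∀ f : Lp ℝ p S.μ, ℓ f = ∫ x in B a, f x ∂S.μ :=
    fun a => by
      by_cases ha : a ∈ t
      · obtain ⟨ℓ, hℓ⟩ := exists_setIntegral_clm (S := S) (p := p) (q := q) (hB a ha)
        exact ⟨ℓ, fun _ => hℓ⟩
      · exact ⟨0, fun h => absurd h ha⟩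
  choose ℓ hℓ using hℓ
  refine ⟨t, ℓ, D, fun z => ?_⟩
  set F : S.W p → Lp ℝ p S.μ := fun z => z.1.fst with hF
  have hFc : Continuous F :=
    (WithLp.fstL p ℝ (Lp ℝ p S.μ) (Lp (E m) p S.μ)).continuous.comp continuous_subtype_val
  set A : Set (S.W p) := {z | ‖LpToLpRestrictCLM (E n) ℝ ℝ S.μ p K (F z)‖ ≤
        ε * ‖z‖ + D * ∑ a ∈ t, ‖ℓ a (F z)‖} with hA
  have hAcl : IsClosed A := by
    refine isClosed_le ((ContinuousLinearMap.continuous _).comp hFc).norm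
      ((continuous_const.mul continuous_norm).add (continuous_const.mul ?_))
    exact continuous_finsetSum _ fun a _ => ((ℓ a).continuous.comp hFc).norm
  have hsub : (S.C1c p : Set (S.W p)) ⊆ A := by
    rintro z ⟨φ, hφ, hzφ⟩
    have hz2 := snd_ae_eq_pointGrad z hφ hzφ
    have hμK : S.μ.restrict K = volume.restrict K := Measure.restrict_restrict_of_subset hKΩ
    have hzK : LpToLpRestrictCLM (E n) ℝ ℝ S.μ p K z.1.fst =ᵐ[S.μ.restrict K] φ :=
      (LpToLpRestrictCLM_coeFn ℝ K z.1.fst).trans (ae_restrict_of_ae hzφ)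
    have e1 : ‖LpToLpRestrictCLM (E n) ℝ ℝ S.μ p K z.1.fst‖ =
        (eLpNorm φ p (volume.restrict K)).toReal := by
      rw [Lp.norm_def, eLpNorm_congr_ae hzK, hμK]
    have e2 : eLpNorm (pointGrad S.X φ) p volume = ‖z.1.snd‖ₑ := by
      rw [Lp.enorm_def, eLpNorm_congr_ae hz2]
      refine (eLpNorm_restrict_eq_of_support_subset fun x hx => ?_).symm
      by_contra hxΩ
      exact hx (pointGrad_eq_zero S.X fun h => hxΩ (hφ.2.2 h))
    have e3 : ∀ a ∈ t, ∫ x in B a, φ x = ℓ a z.1.fst := fun a ha => by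
      rw [hℓ a ha, integral_congr_ae (ae_restrict_of_ae hzφ),
        Measure.restrict_restrict (hB a ha)]
      refine (setIntegral_eq_of_subset_of_forall_sdiff_eq_zero (hB a ha) inter_subset_left
        fun x hx => hφ.eq_zero fun h => hx.2 ⟨hx.1, h⟩).symm ▸ rfl
    have hmain := hest φ hφ
    rw [e2, Finset.sum_congr rfl fun a ha => by rw [e3 a ha]] at hmain
    have hmain' := toReal_le_of_le_enorm hε.le z.1.snd hmain
    rw [hA, mem_ofPred_eq, hF, e1]
    refine hmain'.trans ?_
    gcongr
    exact WithLp.norm_snd_le (α := Lp ℝ p S.μ) z.1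
  exact closure_minimal hsub hAcl z.2

/-- Rellich's theorem on compact subsets of `Ω`: weak convergence in `V` implies strong convergence
in `L^p(K)`. -/
theorem tendsto_restrict_of_weakTendsto (h1 : S.H1) (h2 : S.H2) (h3 : S.H3) {p q : ℝ≥0∞}
    [Fact (1 ≤ p)] [Fact (1 ≤ q)] [p.HolderConjugate q] (hp : p ≠ ∞) (hp1 : 1 < p)
    {K : Set (E n)} (hK : IsCompact K) (hKΩ : K ⊆ S.Ω) {v : ℕ → S.V p} {v₀ : S.V p}
    (hv : WeakTendsto v v₀) :
    Tendsto (fun h => ‖LpToLpRestrictCLM (E n) ℝ ℝ S.μ p K ((v h - v₀).1.1.fst)‖) atTop (𝓝 0) := by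
  obtain ⟨C, hC⟩ := hv.exists_norm_le
  have hC' : ∀ h, ‖v h - v₀‖ ≤ C + ‖v₀‖ := fun h =>
    (norm_sub_le _ _).trans (add_le_add (hC h) le_rfl)
  have hC0 : 0 ≤ C + ‖v₀‖ := (norm_nonneg _).trans (hC' 0)
  refine Metric.tendsto_atTop.2 fun ε hε => ?_
  obtain ⟨t, ℓ, D, hest⟩ := exists_norm_restrict_le h1 h2 h3 (q := q) hp hp1 hK hKΩ
    (ε := ε / 2 / (C + ‖v₀‖ + 1)) (by positivity)
  have hlim : Tendsto (fun h => D * ∑ a ∈ t, ‖ℓ a ((v h - v₀).1.1.fst)‖) atTop (𝓝 0) := by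
    have : Tendsto (fun h => D * ∑ a ∈ t, ‖ℓ a ((v h - v₀).1.1.fst)‖) atTop
        (𝓝 (D * ∑ a ∈ t, 0)) := by
      refine (tendsto_finsetSum _ fun a _ => ?_).const_mul D
      have hf := hv (ℓ a ∘L WithLp.fstL p ℝ (Lp ℝ p S.μ) (Lp (E m) p S.μ) ∘L
        (S.W p).subtypeL ∘L (S.V p).subtypeL)
      have hf' := (hf.sub_const (ℓ a v₀.1.1.fst)).norm
      have e : ∀ h, ℓ a ((v h - v₀).1.1.fst) = ℓ a ((v h).1.1.fst) - ℓ a v₀.1.1.fst := fun h =>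
        map_sub (ℓ a) _ _
      simp only [e]
      convert! hf' using 2
      exact (norm_eq_zero.2 (sub_self _)).symm
    simpa using this
  obtain ⟨N, hN⟩ := Metric.tendsto_atTop.1 hlim (ε / 2) (by positivity)
  refine ⟨N, fun h hh => ?_⟩
  have h4 := hN h hh
  rw [Real.dist_eq, sub_zero] at h4 ⊢
  rw [abs_of_nonneg (norm_nonneg _)]
  have h5 : ε / 2 / (C + ‖v₀‖ + 1) * ‖v h - v₀‖ ≤ ε / 2 := by
    rw [div_mul_eq_mul_div, div_le_iff₀ (by positivity)]
    gcongr
    linarith [hC' h]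
  linarith [hest (v h - v₀), le_abs_self (D * ∑ a ∈ t, ‖ℓ a ((v h - v₀).1.1.fst)‖)]

end Setting

end XGrad

namespace XGrad

/-! ### Multiplication by test functions -/

theorem exists_restrict_clm {Y : Type*} [NormedAddCommGroup Y] [NormedSpace ℝ Y]
    (U : Submodule ℝ Y) (T : Y →L[ℝ] Y) (h : ∀ z ∈ U, T z ∈ U) :
    ∃ N : U →L[ℝ] U, ∀ v : U, (N v : Y) = T v :=
  ⟨T.restrict h, fun _ => rfl⟩

namespace Setting

variable {n m : ℕ} {S : Setting n m}

theorem grad_apply {p : ℝ≥0∞} [Fact (1 ≤ p)] (v : S.V p) : S.grad p v = v.1.1.snd := rfl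

/-- The product rule for distributional `X`-gradients. -/
theorem IsXGrad.mul_test {p : ℝ≥0∞} [Fact (1 ≤ p)] {u : Lp ℝ p S.μ} {w : Lp (E m) p S.μ}
    (h : S.IsXGrad u w) {φ : E n → ℝ} (hφ : S.IsTest ⊤ φ) :
    S.IsXGrad (fun x => φ x * u x) (fun x => φ x • w x + u x • pointGrad S.X φ x) := by
  intro j η hη
  have hφ1 : S.IsTest 1 φ := hφ.of_le le_top
  have hη1 : S.IsTest 1 η := hη.of_le le_top
  have hu : Integrable u S.μ := (Lp.memLp u).integrable Fact.out
  have hcg : Continuous fun x => pointGrad S.X φ x j * η x :=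
    ((EuclideanSpace.proj (𝕜 := ℝ) j).continuous.comp hφ1.continuous_pointGrad).mul hη.continuous
  obtain ⟨A, hA⟩ := HasCompactSupport.exists_bound_of_continuous (hη.2.1.mul_left) hcg
  have hi : Integrable (fun x => u x * (pointGrad S.X φ x j * η x)) S.μ :=
    hu.mul_bdd (c := A) hcg.aestronglyMeasurable (Eventually.of_forall hA)
  calc ∫ x in S.Ω, (φ x * u x) * S.adj j η x
      = ∫ x in S.Ω, (u x * S.adj j (fun x => φ x * η x) x +
          u x * (pointGrad S.X φ x j * η x)) := by
        refine integral_congr_ae ?_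
        filter_upwards [ae_restrict_of_ae (adj_mul_ae hφ1 hη1 j)] with x hx
        rw [hx]; ring
    _ = ∫ x in S.Ω, (w x j * (φ x * η x) + u x * (pointGrad S.X φ x j * η x)) := by
        rw [integral_add (S.integrable_mul_adj u j (hφ.mul hη)) hi, h j _ (hφ.mul hη),
          ← integral_add (S.integrable_coord_mul w j (hφ.mul hη)) hi]
    _ = ∫ x in S.Ω, (φ x • w x + u x • pointGrad S.X φ x) j * η x :=
        integral_congr_ae (Eventually.of_forall fun x => by simp; ring)

/-- Pointwise multiplication by a continuous, compactly supported function is bounded on `L^p`. -/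
theorem exists_mul_clm {p : ℝ≥0∞} [Fact (1 ≤ p)] {F G H : Type*} [NormedAddCommGroup F]
    [NormedSpace ℝ F] [NormedAddCommGroup G] [NormedSpace ℝ G] [NormedAddCommGroup H]
    [NormedSpace ℝ H] (B : F →L[ℝ] G →L[ℝ] H) {f : E n → F} (hf : Continuous f)
    (hfc : HasCompactSupport f) :
    ∃ T : Lp G p S.μ →L[ℝ] Lp H p S.μ, ∀ u, T u =ᵐ[S.μ] fun x => B (f x) (u x) := by
  obtain ⟨A, hA⟩ := hfc.exists_bound_of_continuous hf
  have hm : MemLp f ∞ S.μ :=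
    memLp_top_of_bound hf.aestronglyMeasurable A
      (Eventually.of_forall hA)
  refine ⟨B.holderL S.μ ∞ p p hm.toLp, fun u => ?_⟩
  filter_upwards [B.coeFn_holder (r := p) hm.toLp u, hm.coeFn_toLp] with x h1 h2
  rw [h2] at h1
  exact h1

set_option maxHeartbeats 800000 in
/-- Multiplication by a test function on `V`, given the operators `u ↦ φ u`, `w ↦ φ w` and
`u ↦ u Xφ` on `L^p`. -/
theorem exists_mul_test_clm {p : ℝ≥0∞} [Fact (1 ≤ p)] {φ : E n → ℝ} (hφ : S.IsTest ⊤ φ)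
    {M₁ : Lp ℝ p S.μ →L[ℝ] Lp ℝ p S.μ} {M₂ : Lp (E m) p S.μ →L[ℝ] Lp (E m) p S.μ}
    {P : Lp ℝ p S.μ →L[ℝ] Lp (E m) p S.μ}
    (hM₁ : ∀ u, M₁ u =ᵐ[S.μ] fun x => φ x * u x)
    (hM₂ : ∀ w, M₂ w =ᵐ[S.μ] fun x => φ x • w x)
    (hP : ∀ u, P u =ᵐ[S.μ] fun x => u x • pointGrad S.X φ x) :
    ∃ N : S.V p →L[ℝ] S.V p,
      ∀ v, S.grad p (N v) =ᵐ[S.μ] fun x => φ x • S.grad p v x + P v.1.1.fst x := by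
  have hφ1 : S.IsTest 1 φ := hφ.of_le le_top
  obtain ⟨N₀, hN1, hN2⟩ : ∃ N₀ : WithLp p (Lp ℝ p S.μ × Lp (E m) p S.μ) →L[ℝ]
      WithLp p (Lp ℝ p S.μ × Lp (E m) p S.μ),
      (∀ z, (N₀ z).fst = M₁ z.fst) ∧ ∀ z, (N₀ z).snd = M₂ z.snd + P z.fst :=
    ⟨(WithLp.prodContinuousLinearEquiv p ℝ (Lp ℝ p S.μ) (Lp (E m) p S.μ)).symm ∘L
      (M₁ ∘L WithLp.fstL p ℝ (Lp ℝ p S.μ) (Lp (E m) p S.μ)).prod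
        (M₂ ∘L WithLp.sndL p ℝ (Lp ℝ p S.μ) (Lp (E m) p S.μ) +
          P ∘L WithLp.fstL p ℝ (Lp ℝ p S.μ) (Lp (E m) p S.μ)),
      fun z => rfl, fun z => rfl⟩
  have hN2e : ∀ z, (N₀ z).snd =ᵐ[S.μ] fun x => φ x • z.snd x + P z.fst x := fun z => by
    rw [hN2]
    filter_upwards [Lp.coeFn_add (M₂ z.snd) (P z.fst), hM₂ z.snd] with x h1 h2
    rw [h1, Pi.add_apply, h2]
  have hNW : ∀ z ∈ S.W p, N₀ z ∈ S.W p := fun z hz j η hη => by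
    have h := IsXGrad.mul_test hz hφ j η hη
    rw [hN1]
    calc ∫ x in S.Ω, M₁ z.fst x * S.adj j η x = ∫ x in S.Ω, (φ x * z.fst x) * S.adj j η x := by
          refine integral_congr_ae ?_
          filter_upwards [hM₁ z.fst] with x hx
          rw [hx]
      _ = _ := h
      _ = ∫ x in S.Ω, (N₀ z).snd x j * η x := by
          refine integral_congr_ae ?_
          filter_upwards [hN2e z, hP z.fst] with x h1 h2
          rw [h1, h2]
  obtain ⟨NW, hNWe⟩ : ∃ NW : S.W p →L[ℝ] S.W p, ∀ z, (NW z).1 = N₀ z.1 :=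
    exists_restrict_clm (S.W p) N₀ hNW
  have hNV : ∀ z ∈ S.V p, NW z ∈ S.V p := fun z hz => by
    refine map_mem_closure NW.continuous hz fun y hy => ?_
    obtain ⟨ψ, hψ, hyψ⟩ := hy
    refine ⟨fun x => φ x * ψ x, hφ1.mul hψ, ?_⟩
    rw [hNWe, hN1]
    filter_upwards [hM₁ y.1.fst, hyψ] with x h1 h2
    rw [h1, h2]
  obtain ⟨N, hNe⟩ : ∃ N : S.V p →L[ℝ] S.V p, ∀ v, (N v).1 = NW v.1 :=
    exists_restrict_clm (S.V p) NW hNV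
  refine ⟨N, fun v => ?_⟩
  rw [grad_apply, grad_apply, hNe, hNWe]
  exact hN2e v.1.1

/-! ### Compensated compactness -/

theorem integrable_inner_lp {p q : ℝ≥0∞} [Fact (1 ≤ p)] [Fact (1 ≤ q)] [p.HolderConjugate q]
    (a : Lp (E m) p S.μ) (M : Lp (E m) q S.μ) : Integrable (fun x => inner ℝ (M x) (a x)) S.μ := by
  refine (L1.integrable_coeFn ((innerSL ℝ (E := E m)).holder 1 a M)).congr ?_
  filter_upwards [(innerSL ℝ (E := E m)).coeFn_holder (r := 1) a M] with x hx
  rw [hx]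
  exact real_inner_comm (M x) (a x)

theorem lpPairing_innerSL_apply {p q : ℝ≥0∞} [Fact (1 ≤ p)] [Fact (1 ≤ q)] [p.HolderConjugate q]
    (a : Lp (E m) p S.μ) (M : Lp (E m) q S.μ) :
    (innerSL ℝ (E := E m)).lpPairing S.μ p q a M = ∫ x in S.Ω, inner ℝ (M x) (a x) := by
  refine ((innerSL ℝ (E := E m)).lpPairing_eq_integral a M).trans ?_
  exact integral_congr_ae (Eventually.of_forall fun x => real_inner_comm (M x) (a x))

/-- `∫ (M, Xv) φ = ⟨div_X M, φ v⟩ - ∫ v (M, Xφ)`. -/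
theorem integral_inner_mul_test {p q : ℝ≥0∞} [Fact (1 ≤ p)] [Fact (1 ≤ q)]
    [p.HolderConjugate q] {φ : E n → ℝ} {N : S.V p →L[ℝ] S.V p}
    {P : Lp ℝ p S.μ →L[ℝ] Lp (E m) p S.μ}
    (hN : ∀ v, S.grad p (N v) =ᵐ[S.μ] fun x => φ x • S.grad p v x + P v.1.1.fst x)
    (v : S.V p) (M : Lp (E m) q S.μ) :
    ∫ x in S.Ω, inner ℝ (M x) (S.grad p v x) * φ x =
      S.divX p q M (N v) - (innerSL ℝ (E := E m)).lpPairing S.μ p q (P v.1.1.fst) M := by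
  rw [S.divX_apply, lpPairing_innerSL_apply,
    ← integral_sub (integrable_inner_lp _ _) (integrable_inner_lp _ _)]
  refine integral_congr_ae ?_
  filter_upwards [hN v] with x hx
  rw [hx, inner_add_right, real_inner_smul_right]
  ring

/-- `u ↦ u Xφ` only sees the restriction of `u` to the support of `φ`. -/
theorem exists_norm_le_restrict {p : ℝ≥0∞} [Fact (1 ≤ p)] {φ : E n → ℝ} (hφ : S.IsTest ⊤ φ)
    {P : Lp ℝ p S.μ →L[ℝ] Lp (E m) p S.μ}
    (hP : ∀ u, P u =ᵐ[S.μ] fun x => u x • pointGrad S.X φ x) :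
    ∃ A : ℝ, ∀ u, ‖P u‖ ≤ A * ‖LpToLpRestrictCLM (E n) ℝ ℝ S.μ p (tsupport φ) u‖ := by
  have hφ1 : S.IsTest 1 φ := hφ.of_le le_top
  obtain ⟨A, hA⟩ := hφ1.hasCompactSupport_pointGrad.exists_bound_of_continuous
    hφ1.continuous_pointGrad
  have hA0 : 0 ≤ A := (norm_nonneg _).trans (hA 0)
  refine ⟨A, fun u => ?_⟩
  have e1 : eLpNorm (P u) p S.μ =
      eLpNorm (fun x => u x • pointGrad S.X φ x) p (S.μ.restrict (tsupport φ)) := by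
    rw [eLpNorm_congr_ae (hP u)]
    refine (eLpNorm_restrict_eq_of_support_subset fun x hx => ?_).symm
    by_contra h
    exact hx (by simp [pointGrad_eq_zero S.X h])
  have e2 : eLpNorm (P u) p S.μ ≤ ENNReal.ofReal A * eLpNorm u p (S.μ.restrict (tsupport φ)) := by
    rw [e1]
    refine eLpNorm_le_mul_eLpNorm_of_ae_le_mul (Eventually.of_forall fun x => ?_) p
    rw [norm_smul, mul_comm]
    gcongr
    exact hA x
  rw [Lp.norm_def, Lp.norm_def, eLpNorm_congr_ae (LpToLpRestrictCLM_coeFn ℝ (tsupport φ) u),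
    ← ENNReal.toReal_ofReal hA0, ← ENNReal.toReal_mul]
  refine ENNReal.toReal_mono (ENNReal.mul_ne_top ENNReal.ofReal_ne_top ?_) (by
    exact e2)
  exact ((Lp.memLp u).restrict _).eLpNorm_ne_top

end Setting

end XGrad

set_option maxHeartbeats 800000 in
theorem theorem3p1 {n m : ℕ} (hmn : m ≤ n) (S : XGrad.Setting n m)
    (h1 : S.H1) (h2 : S.H2) (h3 : S.H3) (hLIC : S.LIC)
    (p q : ℝ≥0∞) [Fact (1 ≤ p)] [Fact (1 ≤ q)] [p.HolderConjugate q]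
    (hp : 2 ≤ p) (hp' : p < ∞)
    (v : ℕ → S.V p) (v₀ : S.V p) (M : ℕ → Lp (XGrad.E m) q S.μ) (M₀ : Lp (XGrad.E m) q S.μ)
    (hv : XGrad.WeakTendsto v v₀) (hM : XGrad.WeakTendsto M M₀)
    (g : StrongDual ℝ (S.V p)) (hdiv : ∀ h, S.divX p q (M h) = g) :
    S.TendstoDistrib (fun h x => inner ℝ (M h x) (S.grad p (v h) x))
      (fun x => inner ℝ (M₀ x) (S.grad p v₀ x)) := by
  refine ⟨fun h => IntegrableOn.locallyIntegrableOn (XGrad.Setting.integrable_inner_lp _ _),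
    IntegrableOn.locallyIntegrableOn (XGrad.Setting.integrable_inner_lp _ _), fun φ hφ => ?_⟩
  have hφ1 : S.IsTest 1 φ := hφ.of_le le_top
  obtain ⟨M₁, hM₁⟩ := XGrad.Setting.exists_mul_clm (S := S) (p := p)
    (ContinuousLinearMap.mul ℝ ℝ) hφ.continuous hφ.2.1
  obtain ⟨M₂, hM₂⟩ := XGrad.Setting.exists_mul_clm (S := S) (p := p)
    (ContinuousLinearMap.lsmul ℝ ℝ (E := XGrad.E m)) hφ.continuous hφ.2.1
  obtain ⟨P, hP⟩ := XGrad.Setting.exists_mul_clm (S := S) (p := p)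
    (ContinuousLinearMap.lsmul ℝ ℝ (E := XGrad.E m)).flip hφ1.continuous_pointGrad
    hφ1.hasCompactSupport_pointGrad
  obtain ⟨N, hN⟩ := XGrad.Setting.exists_mul_test_clm hφ hM₁ hM₂ hP
  obtain ⟨A, hA⟩ := XGrad.Setting.exists_norm_le_restrict hφ hP
  set B := (innerSL ℝ (E := XGrad.E m)).lpPairing S.μ p q with hB
  have hdiv₀ : S.divX p q M₀ = g := by
    ext z
    refine tendsto_nhds_unique (hM (B (S.grad p z))) ?_
    have e : ∀ h, B (S.grad p z) (M h) = g z := fun h => by rw [← hdiv h]; rfl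
    simp only [e, tendsto_const_nhds]
  simp only [XGrad.Setting.integral_inner_mul_test hN, hdiv, hdiv₀]
  refine (hv (g ∘L N)).sub ?_
  refine XGrad.WeakTendsto.tendsto_bilin B (tendsto_iff_norm_sub_tendsto_zero.2 ?_) hM
  have hr := XGrad.Setting.tendsto_restrict_of_weakTendsto h1 h2 h3 (q := q) hp'.ne
    (lt_of_lt_of_le (by norm_num) hp) hφ.2.1 hφ.2.2 hv
  refine squeeze_zero (fun h => norm_nonneg _) (fun h => ?_) (by
    simpa only [mul_zero] using hr.const_mul A)
  rw [← map_sub P]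
  exact hA ((v h - v₀).1.1.fst)
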